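/- **Setting.** Let $k$ be a field of characteristic $0$, let $\mathfrak g$ be a finite-dimensional split simple Lie algebra over $k$ with Killing form $(\cdot\mid\cdot)$, let $R$ and $S$ be commutative unital $k$-algebras, and let $S/R$ be a finite Galois ring extension with Galois group $G$. This means that $G$ is a finite group acting on $S$ by $k$-algebra automorphisms, that $R\to S$ is injective with image $S^G$, and that there are $x_1,\dots,x_n,y_1,\dots,y_n\in S$ with $\sum_i x_i\,{}^{g}y_i=\delta_{g,1}$ for all $g\in G$. Write $\mathfrak g_S=\mathfrak g\otimes_k S$, with $G$ acting by ${}^{g}(x\otimes s)=x\otimes{}^{g}s$. Let $\Omega_R,\Omega_S$ be the Kähler differentials of $R$ and $S$ over $k$, and let $\overline{a\,db}$ denote the class of $a\,db$ modulo exact differentials. Let $\widehat{\mathfrak g_S}=\mathfrak g_S\oplus\Omega_S/dS$ be the $k$-Lie algebra in which $\Omega_S/dS$ is central and $$[x\otimes a,\;y\otimes b]=[x,y]\otimes ab\;\oplus\;(x\mid y)\,\overline{a\,db}.$$ The group $G$ acts on it by ${}^{g}\big((x\otimes s)\oplus\overline{a\,db}\big)=(x\otimes{}^{g}s)\oplus\overline{{}^{g}a\,d({}^{g}b)}$.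 Let $u=(u_g)_{g\in G}\in Z^1(G,\mathrm{Aut}_S(\mathfrak g_S))$ be a constant cocycle, i.e. $u_g=v_g\otimes\mathrm{id}$ with $v_g\in\mathrm{Aut}_k(\mathfrak g)$; that is, $u_{gh}=u_g\,{}^{g}u_h$, where ${}^{g}\theta=(1\otimes g)\circ\theta\circ(1\otimes g^{-1})$. Let $\widehat u_g$ be the lift of $u_g$ to an automorphism of the $k$-Lie algebra $\widehat{\mathfrak g_S}$. Put $$L_u=\{X\in\mathfrak g_S: u_g\,{}^{g}X=X\ \ \forall g\in G\},\qquad L_{\widehat u}=\{x\in\widehat{\mathfrak g_S}:\widehat u_g\,{}^{g}x=x\ \ \forall g\in G\},$$ regarded as Lie algebras over $k$, and let $\mathfrak g_0=\{x\in\mathfrak g: v_g(x)=x\ \ \forall g\in G\}$. **Proposition 3.7.** Assume that 1. the Lie algebra $\mathfrak g_0$ is central simple over $k$ (simple, with centroid $k$); 2. $\mathfrak g$ has a $k$-basis consisting of simultaneous eigenvectors of the $v_g$, $g\in G$; 3. $L_{\widehat u}=L_u\oplus\Omega_R/dR$ as subspaces of $\mathfrak g_S\oplus\Omega_S/dS$,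 where $\Omega_R/dR$ stands for its image under the natural map $\Omega_R/dR\to\Omega_S/dS$. Then the projection $L_{\widehat u}\to L_u$ is the universal central extension of $L_u$: it is a surjective homomorphism of $k$-Lie algebras with central kernel, and for every central extension $q:E\to L_u$ of $k$-Lie algebras there is exactly one homomorphism of $k$-Lie algebras $\psi:L_{\widehat u}\to E$ such that $q\circ\psi$ is the projection $L_{\widehat u}\to L_u$. -/

import Mathlib

open scoped TensorProduct KaehlerDifferential

universe w

noncomputable section

namespace TwistedUCE

/-! ### Galois extensions of commutative rings -/

/-- `S / R` is a Galois extension of commutative rings with (finite) Galois group `G`, in the sense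
of Auslander--Goldman and Chase--Harrison--Rosenberg: `R → S` is injective, its image is the
ring of invariants `S ^ G`, and there are Galois coordinates `x i, y i` in `S`, i.e.
`∑ i, x i * g (y i)` is `1` for `g = 1` and `0` for `g ≠ 1`. -/
structure IsGaloisExtension (R S G : Type*) [CommRing R] [CommRing S] [Algebra R S] [Group G]
    [MulSemiringAction G S] : Prop where
  finite : Finite G
  algebraMap_injective : Function.Injective (algebraMap R S)
  fixed_iff : ∀ s : S, (∀ g : G, g • s = s) ↔ s ∈ Set.range (algebraMap R S)
  coordinates : ∃ (n : ℕ) (x y : Fin n → S), ∑ i, x i * y i = 1 ∧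
    ∀ g : G, g ≠ 1 → ∑ i, x i * g • y i = 0

/-! ### Split simple and central simple Lie algebras -/

/-- A split simple Lie algebra over a field: it is simple and has a splitting Cartan subalgebra `H`,
i.e. all `ad h` with `h ∈ H` are triangularizable over `k`. -/
def IsSplitSimple (k L : Type*) [Field k] [LieRing L] [LieAlgebra k L] : Prop :=
  LieAlgebra.IsSimple k L ∧
    ∃ H : LieSubalgebra k L, ∃ _ : H.IsCartanSubalgebra, LieModule.IsTriangularizable k H L

/-- A central simple Lie algebra over a field: it is simple and its centroid consists of the
scalars only. -/
def IsCentralSimple (k L : Type*) [Field k] [LieRing L] [LieAlgebra k L] : Prop :=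
  LieAlgebra.IsSimple k L ∧
    ∀ φ : L →ₗ[k] L, (∀ x y : L, φ ⁅x, y⁆ = ⁅x, φ y⁆) → ∃ c : k, ∀ x, φ x = c • x

/-! ### Central extensions -/

section Central

variable {k E L : Type*} [CommRing k] [LieRing E] [LieAlgebra k E] [LieRing L] [LieAlgebra k L]

/-- `p : E → L` is a central extension of `L`: it is surjective with central kernel. -/
structure IsCentralExtension (p : E →ₗ⁅k⁆ L) : Prop where
  surjective : Function.Surjective p
  central : ∀ x : E, p x = 0 → ∀ y : E, ⁅x, y⁆ = 0

/-- `p : E → L` is a universal central extension of `L`: it is an initial object among the central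
extensions of `L` (tested against central extensions in an arbitrary universe `w`). -/
structure IsUniversalCentralExtension (p : E →ₗ⁅k⁆ L) : Prop
    extends IsCentralExtension p where
  existsUnique : ∀ (M : Type w) [LieRing M] [LieAlgebra k M] (q : M →ₗ⁅k⁆ L),
    IsCentralExtension q → ∃! ψ : E →ₗ⁅k⁆ M, q.comp ψ = p

end Central

/-! ### Kähler differentials modulo exact ones -/

section Omega

variable (k : Type*) [CommRing k]

/-- The `k`-subspace `dA` of `Ω[A⁄k]`. -/
def exactForms (A : Type*) [CommRing A] [Algebra k A] : Submodule k (Ω[A⁄k]) :=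
  LinearMap.range (KaehlerDifferential.D k A : A →ₗ[k] Ω[A⁄k])

/-- The `k`-space `Ω_A / dA`. -/
abbrev OmegaBar (A : Type*) [CommRing A] [Algebra k A] : Type _ := Ω[A⁄k] ⧸ exactForms k A

variable {k} {A B : Type*} [CommRing A] [Algebra k A] [CommRing B] [Algebra k B]

/-- The class of `a db` in `Ω_A / dA`. -/
def omegaMk (a b : A) : OmegaBar k A :=
  (exactForms k A).mkQ (a • KaehlerDifferential.D k A b)

/-- The map `Ω_A → Ω_B`, `a db ↦ f(a) d(f(b))`, induced by a `k`-algebra map `f : A → B`. -/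
def omegaMap (f : A →ₐ[k] B) : Ω[A⁄k] →ₗ[k] Ω[B⁄k] :=
  letI : Algebra A B := f.toRingHom.toAlgebra
  haveI : IsScalarTower k A B := IsScalarTower.of_algebraMap_eq fun c => (f.commutes c).symm
  (KaehlerDifferential.map k k A B).restrictScalars k

theorem omegaMap_smul_D (f : A →ₐ[k] B) (a b : A) :
    omegaMap f (a • KaehlerDifferential.D k A b) = f a • KaehlerDifferential.D k B (f b) := by
  let _ : Algebra A B := f.toRingHom.toAlgebra
  have _ : IsScalarTower k A B := IsScalarTower.of_algebraMap_eq fun c => (f.commutes c).symm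
  change KaehlerDifferential.map k k A B (a • KaehlerDifferential.D k A b) = _
  rw [map_smul, KaehlerDifferential.map_D, algebra_compatible_smul B]
  rfl

theorem exactForms_le_comap (f : A →ₐ[k] B) :
    exactForms k A ≤ (exactForms k B).comap (omegaMap f) := by
  rintro _ ⟨b, rfl⟩
  refine ⟨f b, ?_⟩
  have := omegaMap_smul_D f 1 b
  simp only [one_smul, map_one] at this
  exact this.symm

/-- The map `Ω_A / dA → Ω_B / dB` induced by a `k`-algebra map `A → B`. -/
def omegaBarMap (f : A →ₐ[k] B) : OmegaBar k A →ₗ[k] OmegaBar k B :=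
  (exactForms k A).mapQ (exactForms k B) (omegaMap f) (exactForms_le_comap f)

theorem omegaBarMap_mk (f : A →ₐ[k] B) (a b : A) :
    omegaBarMap f (omegaMk a b) = omegaMk (k := k) (f a) (f b) := by
  simp only [omegaBarMap, omegaMk, Submodule.mkQ_apply, Submodule.mapQ_apply, omegaMap_smul_D]

variable (k A) in
/-- The `k`-bilinear map `(a, b) ↦` class of `a db`. -/
def omegaBilin : A →ₗ[k] A →ₗ[k] OmegaBar k A :=
  LinearMap.mk₂ k omegaMk
    (fun a a' b => by simp [omegaMk, add_smul])
    (fun c a b => by simp [omegaMk, smul_assoc])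
    (fun a b b' => by simp [omegaMk])
    (fun c a b => by simp [omegaMk, smul_comm a c])

theorem omegaMk_leibniz (a b c : A) :
    omegaMk (k := k) a (b * c) = omegaMk (a * b) c + omegaMk (a * c) b := by
  simp [omegaMk, smul_smul]

theorem omegaMk_one (a : A) : omegaMk (k := k) 1 a = 0 := by
  simp only [omegaMk, one_smul, Submodule.mkQ_apply, Submodule.Quotient.mk_eq_zero]
  exact ⟨a, rfl⟩

theorem omegaMk_skew (a b : A) : omegaMk (k := k) a b = - omegaMk b a := by
  have := omegaMk_leibniz (k := k) 1 a b
  rw [omegaMk_one, one_mul, one_mul] at this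
  exact eq_neg_of_add_eq_zero_left this.symm

end Omega

/-! ### Kassel's central extension of `𝔤 ⊗ S` -/

section Kassel

variable (k S 𝔤 : Type*) [Field k] [CommRing S] [Algebra k S]
  [LieRing 𝔤] [LieAlgebra k 𝔤]

/-- The `k`-bilinear map on `𝔤_S` with `P (a ⊗ x, b ⊗ y) = (x | y) • (class of a db)`, where
`(x | y)` is the Killing form of `𝔤`. -/
def kasselForm : (S ⊗[k] 𝔤) →ₗ[k] (S ⊗[k] 𝔤) →ₗ[k] OmegaBar k S :=
  (TensorProduct.map₂ (omegaBilin k S) (killingForm k 𝔤)).compr₂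
    (TensorProduct.rid k (OmegaBar k S)).toLinearMap

theorem kasselForm_tmul (a b : S) (x y : 𝔤) :
    kasselForm k S 𝔤 (a ⊗ₜ x) (b ⊗ₜ y) = killingForm k 𝔤 x y • omegaMk a b := by
  rw [kasselForm, LinearMap.compr₂_apply, TensorProduct.map₂_apply_tmul]
  exact TensorProduct.rid_tmul _ _

theorem kasselForm_skew (X Y : S ⊗[k] 𝔤) :
    kasselForm k S 𝔤 X Y = - kasselForm k S 𝔤 Y X := by
  induction X with
  | zero => simp
  | add X X' h h' => simp only [map_add, LinearMap.add_apply, h, h']; abel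
  | tmul a x =>
    induction Y with
    | zero => simp
    | add Y Y' h h' => simp only [map_add, LinearMap.add_apply, h, h']; abel
    | tmul b y =>
      rw [kasselForm_tmul, kasselForm_tmul, omegaMk_skew a b, smul_neg,
        LieModule.traceForm_comm k 𝔤 𝔤 x y]

theorem kasselForm_cocycle (X Y Z : S ⊗[k] 𝔤) :
    kasselForm k S 𝔤 X ⁅Y, Z⁆ = kasselForm k S 𝔤 ⁅X, Y⁆ Z + kasselForm k S 𝔤 Y ⁅X, Z⁆ := by
  induction X with
  | zero => simp
  | add X X' h h' => simp only [map_add, LinearMap.add_apply, add_lie, h, h']; abel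
  | tmul a x =>
    induction Y with
    | zero => simp
    | add Y Y' h h' => simp only [map_add, LinearMap.add_apply, add_lie, lie_add, h, h']; abel
    | tmul b y =>
      induction Z with
      | zero => simp
      | add Z Z' h h' => simp only [map_add, lie_add, h, h']; abel
      | tmul c z =>
        have h1 : killingForm k 𝔤 x ⁅y, z⁆ = killingForm k 𝔤 ⁅x, y⁆ z :=
          (LieModule.traceForm_apply_lie_apply k 𝔤 𝔤 x y z).symm
        have h2 : killingForm k 𝔤 y ⁅x, z⁆ = - killingForm k 𝔤 ⁅x, y⁆ z := by
          rw [← LieModule.traceForm_apply_lie_apply k 𝔤 𝔤 y x z, ← lie_skew x y, map_neg,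
            LinearMap.neg_apply, neg_neg]
        simp only [LieAlgebra.ExtendScalars.bracket_tmul, kasselForm_tmul, h1, h2, neg_smul]
        rw [← smul_neg, ← smul_add]
        congr 1
        rw [omegaMk_leibniz b a c, mul_comm b a, omegaMk_skew a (b * c)]
        abel

section

variable {k S 𝔤}

/-- The map `id ⊗ f : 𝔤_S → 𝔤_T` induced by a `k`-algebra map `f : S → T`. -/
abbrev currentMap {T : Type*} [CommRing T] [Algebra k T] (f : S →ₐ[k] T) :
    S ⊗[k] 𝔤 →ₗ⁅k⁆ T ⊗[k] 𝔤 :=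
  LieAlgebra.ExtendScalars.map f LieHom.id

theorem kasselForm_currentMap {T : Type*} [CommRing T] [Algebra k T] (f : S →ₐ[k] T)
    (X Y : S ⊗[k] 𝔤) :
    kasselForm k T 𝔤 (currentMap f X) (currentMap f Y) = omegaBarMap f (kasselForm k S 𝔤 X Y) := by
  induction X with
  | zero => simp
  | add X X' h h' => simp only [map_add, LinearMap.add_apply, h, h']
  | tmul a x =>
    induction Y with
    | zero => simp
    | add Y Y' h h' => simp only [map_add, h, h']
    | tmul b y =>
      simp only [LieAlgebra.ExtendScalars.map_apply_tmul, kasselForm_tmul, map_smul,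
        omegaBarMap_mk, LieHom.id_apply]

end

variable [CharZero k]

/-- Kassel's cocycle on `𝔤_S` with values in the trivial module `Ω_S / dS`. -/
def kasselCocycle : LieModule.Cohomology.twoCocycle k (S ⊗[k] 𝔤)
    (TrivialLieModule k (S ⊗[k] 𝔤) (OmegaBar k S)) :=
  ⟨⟨(kasselForm k S 𝔤).compr₂ (TrivialLieModule.equiv k (S ⊗[k] 𝔤) (OmegaBar k S)).symm, fun X => by
      have h : kasselForm k S 𝔤 X X = 0 := by
        have h2 := kasselForm_skew k S 𝔤 X X
        have h3 : (2 : k) • kasselForm k S 𝔤 X X = 0 := by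
          rw [two_smul]; nth_rw 1 [h2]; simp
        exact (smul_eq_zero.mp h3).resolve_left two_ne_zero
      simp [h]⟩,
    (LieModule.Cohomology.mem_twoCocycle_iff_of_trivial ..).mpr fun X Y Z =>
      kasselForm_cocycle k S 𝔤 X Y Z⟩

/-- Kassel's Lie algebra `𝔤_S ⊕ Ω_S / dS`, with bracket
`[X ⊕ z, Y ⊕ w] = [X, Y] ⊕ P (X, Y)`, where `P (a ⊗ x, b ⊗ y) = (x | y) • (class of a db)`. -/
abbrev KasselAlgebra : Type _ := LieAlgebra.ofTwoCocycle (kasselCocycle k S 𝔤)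

variable {k S 𝔤}

/-- The element `X ⊕ z` of `𝔤_S ⊕ Ω_S / dS`. -/
def KasselAlgebra.mk (X : S ⊗[k] 𝔤) (z : OmegaBar k S) : KasselAlgebra k S 𝔤 := ⟨(X, z)⟩

/-- The component in `𝔤_S` of an element of `𝔤_S ⊕ Ω_S / dS`. -/
def KasselAlgebra.fst (x : KasselAlgebra k S 𝔤) : S ⊗[k] 𝔤 := x.carrier.1

/-- The component in `Ω_S / dS` of an element of `𝔤_S ⊕ Ω_S / dS`. -/
def KasselAlgebra.snd (x : KasselAlgebra k S 𝔤) : OmegaBar k S := x.carrier.2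

theorem KasselAlgebra.bracket_mk (X Y : S ⊗[k] 𝔤) (z w : OmegaBar k S) :
    ⁅KasselAlgebra.mk X z, KasselAlgebra.mk Y w⁆ =
      KasselAlgebra.mk ⁅X, Y⁆ (kasselForm k S 𝔤 X Y) := by
  change (LieAlgebra.ofProd (kasselCocycle k S 𝔤) (_, _ + _ - _)) =
    (LieAlgebra.ofProd (kasselCocycle k S 𝔤) (_, _))
  congr 2
  exact (sub_zero _).trans (add_zero _)

variable (k S 𝔤) in
/-- The projection `𝔤_S ⊕ Ω_S / dS → 𝔤_S`. -/
def kasselProj : KasselAlgebra k S 𝔤 →ₗ⁅k⁆ S ⊗[k] 𝔤 where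
  toFun x := x.fst
  map_add' _ _ := rfl
  map_smul' _ _ := rfl
  map_lie' := rfl

/-- The map `𝔤_S ⊕ Ω_S / dS → 𝔤_T ⊕ Ω_T / dT`, `(a ⊗ x) ⊕ z ↦ (f(a) ⊗ x) ⊕ f(z)`, induced by a
`k`-algebra map `f : S → T`. -/
def kasselMap {T : Type*} [CommRing T] [Algebra k T] (f : S →ₐ[k] T) :
    KasselAlgebra k S 𝔤 →ₗ⁅k⁆ KasselAlgebra k T 𝔤 where
  toFun x := .mk (currentMap f x.fst) (omegaBarMap f x.snd)
  map_add' x y := by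
    change KasselAlgebra.mk (currentMap f (x.fst + y.fst)) (omegaBarMap f (x.snd + y.snd)) = _
    rw [map_add, map_add]; rfl
  map_smul' c x := by
    change KasselAlgebra.mk (currentMap f (c • x.fst)) (omegaBarMap f (c • x.snd)) = _
    rw [map_smul, map_smul]; rfl
  map_lie' {x y} := by
    rw [KasselAlgebra.bracket_mk, kasselForm_currentMap, ← LieHom.map_lie]
    change KasselAlgebra.mk _ (omegaBarMap f (KasselAlgebra.snd
      ⁅KasselAlgebra.mk x.fst x.snd, KasselAlgebra.mk y.fst y.snd⁆)) = _
    rw [KasselAlgebra.bracket_mk]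
    rfl

end Kassel

/-! ### Galois descent -/

section Descent

variable (k : Type*) {S 𝔤 G : Type*} [Field k] [CommRing S] [Algebra k S]
  [LieRing 𝔤] [LieAlgebra k 𝔤] [Group G] [MulSemiringAction G S] [SMulCommClass G k S]

variable (𝔤) in
/-- The action of the Galois group on `𝔤_S`: `g (a ⊗ x) = g a ⊗ x`. -/
def galoisAct (g : G) : S ⊗[k] 𝔤 →ₗ⁅k⁆ S ⊗[k] 𝔤 :=
  currentMap (MulSemiringAction.toAlgHom k S g)

variable (𝔤) in
/-- The action of the Galois group on `𝔤_S ⊕ Ω_S / dS`: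
`g ((a ⊗ x) ⊕ z) = (g a ⊗ x) ⊕ g z`, where `g (class of a db) = class of (g a) d(g b)`. -/
def galoisActKassel [CharZero k] (g : G) : KasselAlgebra k S 𝔤 →ₗ⁅k⁆ KasselAlgebra k S 𝔤 :=
  kasselMap (MulSemiringAction.toAlgHom k S g)

variable {k}

/-- `u : G → Aut_S (𝔤_S)` is a cocycle: `u (g h) = u g ∘ ᵍ(u h)`, where
`ᵍθ = g ∘ θ ∘ g⁻¹`. -/
def IsCocycle (u : G → (S ⊗[k] 𝔤) ≃ₗ⁅S⁆ (S ⊗[k] 𝔤)) : Prop :=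
  ∀ (g h : G) (X : S ⊗[k] 𝔤),
    u (g * h) X = u g (galoisAct k 𝔤 g (u h (galoisAct k 𝔤 g⁻¹ X)))

/-- The descended Lie algebra `L_u = {X ∈ 𝔤_S | u g (g X) = X for all g}`, as a Lie algebra
over `k`. -/
def descended (u : G → (S ⊗[k] 𝔤) ≃ₗ⁅S⁆ (S ⊗[k] 𝔤)) : LieSubalgebra k (S ⊗[k] 𝔤) where
  carrier := {X | ∀ g : G, u g (galoisAct k 𝔤 g X) = X}
  add_mem' {X Y} hX hY g := by rw [map_add, map_add, hX g, hY g]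
  zero_mem' g := by rw [map_zero, map_zero]
  smul_mem' c X hX g := by
    rw [map_smul, ← algebraMap_smul S c (galoisAct k 𝔤 g X), map_smul, hX g, algebraMap_smul]
  lie_mem' {X Y} hX hY g := by rw [LieHom.map_lie, LieEquiv.map_lie, hX g, hY g]

/-- The subalgebra `𝔤₀` of the elements of `𝔤` that are fixed by all `v g`. -/
def fixedSubalgebra (v : G → 𝔤 ≃ₗ⁅k⁆ 𝔤) : LieSubalgebra k 𝔤 where
  carrier := {x | ∀ g : G, v g x = x}
  add_mem' {x y} hx hy g := by rw [map_add, hx g, hy g]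
  zero_mem' g := map_zero _
  smul_mem' c x hx g := by rw [map_smul, hx g]
  lie_mem' {x y} hx hy g := by rw [LieEquiv.map_lie, hx g, hy g]

variable [CharZero k]

/-- `uh` consists of lifts of the automorphisms `u g` of `𝔤_S` to automorphisms of the central
extension `𝔤_S ⊕ Ω_S / dS` of `𝔤_S`. -/
def IsLift (u : G → (S ⊗[k] 𝔤) ≃ₗ⁅S⁆ (S ⊗[k] 𝔤))
    (uh : G → KasselAlgebra k S 𝔤 ≃ₗ⁅k⁆ KasselAlgebra k S 𝔤) : Prop :=
  ∀ (g : G) (x : KasselAlgebra k S 𝔤), kasselProj k S 𝔤 (uh g x) = u g (kasselProj k S 𝔤 x)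

/-- The descended central extension `L_û = {x ∈ 𝔤_S ⊕ Ω_S / dS | û g (g x) = x for all g}`. -/
def descendedHat (uh : G → KasselAlgebra k S 𝔤 ≃ₗ⁅k⁆ KasselAlgebra k S 𝔤) :
    LieSubalgebra k (KasselAlgebra k S 𝔤) where
  carrier := {x | ∀ g : G, uh g (galoisActKassel k 𝔤 g x) = x}
  add_mem' {x y} hx hy g := by rw [map_add, map_add, hx g, hy g]
  zero_mem' g := by rw [map_zero, map_zero]
  smul_mem' c x hx g := by rw [map_smul, map_smul, hx g]
  lie_mem' {x y} hx hy g := by rw [LieHom.map_lie, LieEquiv.map_lie, hx g, hy g]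

theorem kasselProj_mem_descended {u : G → (S ⊗[k] 𝔤) ≃ₗ⁅S⁆ (S ⊗[k] 𝔤)}
    {uh : G → KasselAlgebra k S 𝔤 ≃ₗ⁅k⁆ KasselAlgebra k S 𝔤} (h : IsLift u uh)
    (x : descendedHat uh) : kasselProj k S 𝔤 x ∈ descended u := by
  intro g
  have hx := congrArg (kasselProj k S 𝔤) (x.2 g)
  rw [h] at hx
  exact hx

/-- The projection `L_û → L_u`, induced by `𝔤_S ⊕ Ω_S / dS → 𝔤_S`. -/
def descendedProj {u : G → (S ⊗[k] 𝔤) ≃ₗ⁅S⁆ (S ⊗[k] 𝔤)}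
    {uh : G → KasselAlgebra k S 𝔤 ≃ₗ⁅k⁆ KasselAlgebra k S 𝔤} (h : IsLift u uh) :
    descendedHat uh →ₗ⁅k⁆ descended u where
  toFun x := ⟨kasselProj k S 𝔤 x, kasselProj_mem_descended h x⟩
  map_add' _ _ := rfl
  map_smul' _ _ := rfl
  map_lie' := rfl

end Descent

end TwistedUCE

end

/-!
Write `A = 𝔤_S`, `L = descended u` and `κ` for the `S`-bilinear Killing form of `A`, which takes
values in `R` on `L`. A central extension of `L` is described by a `2`-cocycle `h` of `L` with
trivial coefficients, and `descendedHat uh` is spanned by the brackets of elements of `L`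
(`descendedBracket_surjective`). By `IsCentralExtension.isUniversal` it therefore suffices to show
that every linear relation between these brackets is satisfied by `h` (`ker_descendedBracket_le`).

The main tool is a transfer from `L` to `A`: a bilinear map `B` on `L` that is balanced, i.e.
`B (r X, Y) = B (X, r Y)` for `r ∈ R`, yields a bilinear map on `A` with
`(s X, t Y) ↦ B (tr (s t) X, Y)`, which satisfies the same identities and restricts to `|G| B`.
Since `A = S ⊗ 𝔤`, statements about balanced maps on `L` reduce to the finite-dimensional
algebra `𝔤`: balanced invariant maps are functions of `κ` because the centroid of `𝔤` is `k`
(`IsBalanced.exists_eq_killingForm`), and balanced `2`-cocycles are coboundaries by Whitehead's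
lemma (`IsBalanced.exists_primitive`).

For a general cocycle `h` and `r ∈ R`, the defect `h (r X, Y) - h (X, r Y)` is an invariant map, and
automatically balanced since `L` is perfect, so it is `f r (κ (X, Y))`. The function `f` is a
derivation in `r`; it vanishes at `f r 1` by Whitehead's lemma for `𝔤₀`, on which `κ` is not zero.
Hence it is a linear map on `Ω_R / dR`, and modulo its image `h` is a coboundary
(`exists_omegaBar_of_cocycle`). Applied to `h` together with the Kassel cocycle, this shows that a
relation between the brackets in `descendedHat uh` is sent by `h` to the image of some
`ω ∈ Ω_R / dR` that vanishes in `Ω_S / dS`. But `Ω_R / dR → Ω_S / dS` is injective, as a trace map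
shows (`IsGaloisExtension.omegaBarMap_injective`), so `ω = 0`.
-/

noncomputable section

namespace TwistedUCE

/-! ### Invariants of finite-dimensional Lie algebras -/

section Killing

variable {k 𝔨 M : Type*} [Field k] [LieRing 𝔨] [LieAlgebra k 𝔨]
  [AddCommGroup M] [Module k M]

theorem killingForm_lie_left (x y z : 𝔨) :
    killingForm k 𝔨 ⁅x, y⁆ z = killingForm k 𝔨 x ⁅y, z⁆ :=
  LieModule.traceForm_apply_lie_apply k 𝔨 𝔨 x y z

/-- Dual bases for the Killing form. Besides duality, the last clause says that the Casimir
element acts as the identity in the adjoint representation. -/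
theorem exists_killing_dual_bases [FiniteDimensional k 𝔨] [LieAlgebra.IsKilling k 𝔨] :
    ∃ (n : ℕ) (e f : Fin n → 𝔨), (∀ z : 𝔨, ∑ i, killingForm k 𝔨 z (f i) • e i = z) ∧
      (∀ z : 𝔨, ∑ i, killingForm k 𝔨 z (e i) • f i = z) ∧ ∀ z : 𝔨, ∑ i, ⁅f i, ⁅e i, z⁆⁆ = z := by
  have hnd := LieAlgebra.IsKilling.killingForm_nondegenerate k 𝔨
  have hsymm : LinearMap.BilinForm.IsSymm (killingForm k 𝔨) := ⟨LieModule.traceForm_comm k 𝔨 𝔨⟩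
  set b := Module.finBasis k 𝔨
  set c := LinearMap.BilinForm.dualBasis (killingForm k 𝔨) hnd b
  have hrepr (z : 𝔨) (i) : b.repr z i = killingForm k 𝔨 z (c i) := by
    have h1 : LinearMap.BilinForm.dualBasis (killingForm k 𝔨) hnd c = b :=
      LinearMap.BilinForm.dualBasis_dualBasis hnd hsymm b
    conv_lhs => rw [← h1]
    exact LinearMap.BilinForm.dualBasis_repr_apply hnd c z i
  have h1 (z : 𝔨) : ∑ i, killingForm k 𝔨 z (c i) • b i = z := by
    simp_rw [← hrepr]; exact b.sum_repr z
  have h2 (z : 𝔨) : ∑ i, killingForm k 𝔨 z (b i) • c i = z := by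
    conv_rhs => rw [← c.sum_repr z]
    exact Finset.sum_congr rfl fun i _ => by rw [LinearMap.BilinForm.dualBasis_repr_apply]
  refine ⟨_, b, c, h1, h2, fun z => ?_⟩
  refine sub_eq_zero.mp (hnd.1 _ fun y => ?_)
  rw [map_sub, LinearMap.sub_apply, sub_eq_zero, map_sum, LinearMap.sum_apply,
    LieModule.traceForm_comm k 𝔨 𝔨 z y, killingForm_apply_apply,
    LinearMap.trace_eq_matrix_trace k b, Matrix.trace]
  refine Finset.sum_congr rfl fun i _ => ?_
  rw [Matrix.diag_apply, LinearMap.toMatrix_apply, hrepr]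
  simp only [LinearMap.comp_apply, LieAlgebra.ad_apply]
  rw [killingForm_lie_left, LieModule.traceForm_comm, ← lie_skew (b i) z, neg_lie, lie_skew]

/-- Whitehead's lemma for the coadjoint module: a derivation `𝔨 → Hom(𝔨, M)` is inner.
A primitive is `w ↦ ∑ i, p (f i) [e i, w]`, for dual bases `e`, `f`. -/
theorem exists_primitive_of_isKilling [FiniteDimensional k 𝔨] [LieAlgebra.IsKilling k 𝔨]
    (p : 𝔨 →ₗ[k] 𝔨 →ₗ[k] M)
    (hp : ∀ x y z, p ⁅x, y⁆ z = p x ⁅y, z⁆ - p y ⁅x, z⁆) :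
    ∃ l : 𝔨 →ₗ[k] M, ∀ x y, p x y = l ⁅x, y⁆ := by
  obtain ⟨n, e, f, he, hf, hef⟩ := exists_killing_dual_bases (k := k) (𝔨 := 𝔨)
  -- invariance of the Casimir element
  have inv (B : 𝔨 →ₗ[k] 𝔨 →ₗ[k] M) (z : 𝔨) :
      ∑ i, B (f i) ⁅e i, z⁆ = ∑ i, B ⁅z, f i⁆ (e i) := by
    have h1 (i) : B (f i) ⁅e i, z⁆ = ∑ j, killingForm k 𝔨 (e i) ⁅z, f j⁆ • B (f i) (e j) := by
      conv_lhs => rw [← he ⁅e i, z⁆]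
      simp only [map_sum, map_smul, killingForm_lie_left]
    have h2 (j) : B ⁅z, f j⁆ (e j) = ∑ i, killingForm k 𝔨 (e i) ⁅z, f j⁆ • B (f i) (e j) := by
      conv_lhs => rw [← hf ⁅z, f j⁆]
      simp only [map_sum, map_smul, LinearMap.sum_apply, LinearMap.smul_apply,
        LieModule.traceForm_comm k 𝔨 𝔨 ⁅z, f j⁆]
    simp_rw [h1, h2]
    exact Finset.sum_comm
  refine ⟨∑ i, (p (f i)) ∘ₗ (LieAlgebra.ad k 𝔨 (e i)), fun x y => ?_⟩
  have h1 (i) : p (f i) ⁅e i, ⁅x, y⁆⁆ =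
      p (f i) ⁅⁅e i, x⁆, y⁆ + (p x ⁅f i, ⁅e i, y⁆⁆ - p ⁅x, f i⁆ ⁅e i, y⁆) := by
    rw [hp x (f i), sub_sub_cancel, ← map_add, ← leibniz_lie]
  have h2 := inv (p.compl₂ (-(LieAlgebra.ad k 𝔨 y : 𝔨 →ₗ[k] 𝔨))) x
  simp only [LinearMap.compl₂_apply, LinearMap.neg_apply, LieAlgebra.ad_apply, lie_skew] at h2
  have h3 : ∑ i, p x ⁅f i, ⁅e i, y⁆⁆ = p x y := by rw [← map_sum, hef]
  change _ = (∑ i, (p (f i)) ∘ₗ (LieAlgebra.ad k 𝔨 (e i) : 𝔨 →ₗ[k] 𝔨)) ⁅x, y⁆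
  simp only [LinearMap.sum_apply, LinearMap.comp_apply, LieAlgebra.ad_apply, h1,
    Finset.sum_add_distrib, Finset.sum_sub_distrib, h2, h3]
  abel

end Killing

section Split

variable {k 𝔤 M : Type*} [Field k] [CharZero k] [LieRing 𝔤] [LieAlgebra k 𝔤]
  [FiniteDimensional k 𝔤] [AddCommGroup M] [Module k M]

theorem isKilling_of_isSimple (h : LieAlgebra.IsSimple k 𝔤) : LieAlgebra.IsKilling k 𝔤 := by
  have := h
  infer_instance

/-- The centroid of a split simple Lie algebra consists of scalars, since it preserves the
one-dimensional root spaces. -/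
theorem IsSplitSimple.isCentralSimple (h : IsSplitSimple k 𝔤) : IsCentralSimple k 𝔤 := by
  obtain ⟨hs, H, _, _⟩ := h
  have := isKilling_of_isSimple hs
  refine ⟨hs, fun φ hφ => ?_⟩
  have : Nontrivial 𝔤 := by
    by_contra hn
    rw [not_nontrivial_iff_subsingleton] at hn
    exact hs.non_abelian ⟨fun _ _ => Subsingleton.elim _ _⟩
  obtain ⟨α, hα⟩ : ∃ α : LieModule.Weight k H 𝔤, α.IsNonZero := by
    by_contra! hn
    have htop := LieAlgebra.IsKilling.span_weight_isNonZero_eq_top (K := k) (L := 𝔤) (H := H)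
    have hempty : {α : LieModule.Weight k H 𝔤 | α.IsNonZero} = ∅ :=
      Set.eq_empty_iff_forall_notMem.mpr fun α h => h (hn α)
    rw [hempty, Set.image_empty, Submodule.span_empty] at htop
    have : Subsingleton (Module.Dual k H) :=
      (Submodule.subsingleton_iff k).mp (subsingleton_of_bot_eq_top htop)
    have := (Module.subsingleton_dual_iff k (V := H)).mp this
    refine H.ne_bot_of_isCartanSubalgebra ((LieSubalgebra.eq_bot_iff _).mpr fun x hx => ?_)
    exact congrArg Subtype.val (Subsingleton.elim (⟨x, hx⟩ : H) 0)
  obtain ⟨e, heα, he⟩ := α.exists_ne_zero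
  have hφe : φ e ∈ LieAlgebra.rootSpace H α := by
    refine LieModule.weightSpace_le_genWeightSpace 𝔤 α ?_
    rw [LieModule.mem_weightSpace]
    intro x
    have := LieAlgebra.IsKilling.lie_eq_smul_of_mem_rootSpace heα x
    change ⁅(x : 𝔤), φ e⁆ = _
    exact (hφ _ _).symm.trans ((congrArg φ this).trans (map_smul φ _ _))
  obtain ⟨c, hc⟩ := (finrank_eq_one_iff_of_nonzero' (⟨e, heα⟩ : LieAlgebra.rootSpace H α)
    (by simpa [LieSubmodule.mk_eq_zero] using he)).mp
    (LieAlgebra.IsKilling.finrank_rootSpace_eq_one α hα) ⟨φ e, hφe⟩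
  replace hc : c • e = φ e := congrArg Subtype.val hc
  have hker (x : 𝔤) : x ∈ LinearMap.ker (φ - c • (LinearMap.id : 𝔤 →ₗ[k] 𝔤)) ↔ φ x = c • x := by
    simp [sub_eq_zero]
  let I : LieIdeal k 𝔤 :=
    { LinearMap.ker (φ - c • (LinearMap.id : 𝔤 →ₗ[k] 𝔤)) with
      lie_mem := fun {x m} hm => (hker _).mpr (by rw [hφ, (hker m).mp hm, lie_smul]) }
  have hI (x : 𝔤) : x ∈ I ↔ φ x = c • x := hker x
  refine ⟨c, fun x => (hI x).mp ?_⟩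
  rcases hs.eq_bot_or_eq_top I with h | h
  · exact absurd ((LieSubmodule.mem_bot e).mp (h ▸ (hI e).mpr hc.symm)) he
  · exact h ▸ LieSubmodule.mem_top x

/-- Every invariant bilinear map on a central simple Lie algebra is a multiple of the Killing
form. -/
theorem IsCentralSimple.invariant_eq (h : IsCentralSimple k 𝔤) (b : 𝔤 →ₗ[k] 𝔤 →ₗ[k] M)
    (hb : ∀ x y z, b ⁅x, y⁆ z = b x ⁅y, z⁆) :
    ∃ m : M, ∀ x y, b x y = killingForm k 𝔤 x y • m := by
  have := isKilling_of_isSimple h.1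
  have hnd := LieAlgebra.IsKilling.killingForm_nondegenerate k 𝔤
  have key (l : M →ₗ[k] k) : ∃ c : k, ∀ x y, l (b x y) = killingForm k 𝔤 x y * c := by
    -- the form `l ∘ b` is `κ (φ ·, ·)` for an element `φ` of the centroid
    let φ : 𝔤 →ₗ[k] 𝔤 :=
      (LinearMap.BilinForm.toDual (killingForm k 𝔤) hnd).symm.toLinearMap ∘ₗ (b.compr₂ l)
    have hφ (x y : 𝔤) : killingForm k 𝔤 (φ x) y = l (b x y) :=
      LinearMap.BilinForm.apply_toDual_symm_apply (hB := hnd) _ _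
    obtain ⟨c, hc⟩ := h.2 φ fun x y => sub_eq_zero.mp <| hnd.1 _ fun z => by
      rw [map_sub, LinearMap.sub_apply, sub_eq_zero, hφ, ← lie_skew x (φ y), map_neg,
        LinearMap.neg_apply, killingForm_lie_left, hφ, ← lie_skew x y, map_neg,
        LinearMap.neg_apply, map_neg, hb]
    exact ⟨c, fun x y => by rw [← hφ, hc, map_smul, LinearMap.smul_apply, smul_eq_mul, mul_comm]⟩
  by_cases h0 : ∀ x y, killingForm k 𝔤 x y = 0
  · refine ⟨0, fun x y => ?_⟩
    rw [smul_zero]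
    refine (Module.forall_dual_apply_eq_zero_iff k _).mp fun l => ?_
    obtain ⟨c, hc⟩ := key l
    rw [hc, h0, zero_mul]
  · push Not at h0
    obtain ⟨x₀, y₀, h0⟩ := h0
    refine ⟨(killingForm k 𝔤 x₀ y₀)⁻¹ • b x₀ y₀, fun x y => sub_eq_zero.mp ?_⟩
    refine (Module.forall_dual_apply_eq_zero_iff k _).mp fun l => ?_
    obtain ⟨c, hc⟩ := key l
    rw [map_sub, map_smul, map_smul, hc, hc, smul_eq_mul, smul_eq_mul, inv_mul_cancel_left₀ h0,
      sub_self]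

end Split

/-! ### Differentials modulo exact forms -/

section Omega

variable {k A M : Type*} [CommRing k] [CommRing A] [Algebra k A] [AddCommGroup M] [Module k M]

theorem omegaBar_induction {p : OmegaBar k A → Prop} (w : OmegaBar k A)
    (mk : ∀ a b : A, p (omegaMk a b)) (add : ∀ w w', p w → p w' → p (w + w')) : p w := by
  obtain ⟨w, rfl⟩ := (exactForms k A).mkQ_surjective w
  have hw : w ∈ Submodule.span A (Set.range (KaehlerDifferential.D k A)) := by
    rw [KaehlerDifferential.span_range_derivation]; trivial
  induction hw using Submodule.closure_induction with
  | zero => simpa [omegaMk] using mk 0 0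
  | add w w' _ _ h h' => rw [map_add]; exact add _ _ h h'
  | smul_mem a w h =>
    obtain ⟨b, rfl⟩ := h
    exact mk a b

variable (k A M) in
/-- The `k`-linear maps `A → M`, with the `A`-module structure `(a • φ) b = φ (a * b)`. -/
def CoinducedModule : Type _ := A →ₗ[k] M

instance : AddCommGroup (CoinducedModule k A M) := inferInstanceAs (AddCommGroup (A →ₗ[k] M))

instance : Module k (CoinducedModule k A M) := inferInstanceAs (Module k (A →ₗ[k] M))

instance : FunLike (CoinducedModule k A M) A M := inferInstanceAs (FunLike (A →ₗ[k] M) A M)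

instance : LinearMapClass (CoinducedModule k A M) k A M :=
  inferInstanceAs (LinearMapClass (A →ₗ[k] M) k A M)

instance : SMul A (CoinducedModule k A M) :=
  ⟨fun a φ => (LinearMap.comp (φ : A →ₗ[k] M) (LinearMap.mulLeft k a) : A →ₗ[k] M)⟩

theorem CoinducedModule.smul_apply (a : A) (φ : CoinducedModule k A M) (b : A) :
    (a • φ) b = φ (a * b) := rfl

instance : Module A (CoinducedModule k A M) where
  one_smul φ := DFunLike.ext _ _ fun b => by rw [CoinducedModule.smul_apply, one_mul]
  mul_smul a a' φ := DFunLike.ext _ _ fun b => by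
    simp only [CoinducedModule.smul_apply, mul_assoc, mul_left_comm]
  smul_zero _ := rfl
  smul_add _ _ _ := rfl
  add_smul a a' φ := DFunLike.ext _ _ fun b => by
    rw [CoinducedModule.smul_apply, add_mul, map_add]; rfl
  zero_smul φ := DFunLike.ext _ _ fun b => by
    rw [CoinducedModule.smul_apply, zero_mul, map_zero]; rfl

instance : IsScalarTower k A (CoinducedModule k A M) where
  smul_assoc c a φ := DFunLike.ext _ _ fun b => by
    rw [CoinducedModule.smul_apply, smul_mul_assoc, map_smul]; rfl

/-- The universal property of `Ω_A / dA`: a bilinear map `f (b, a)` that is a derivation in `b` and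
vanishes for `a = 1` is induced by a linear map on `Ω_A / dA`, at the class of `a db`. -/
theorem exists_omegaBar_lift (f : A →ₗ[k] A →ₗ[k] M)
    (hmul : ∀ b b' a, f (b * b') a = f b (b' * a) + f b' (b * a)) (hone : ∀ b, f b 1 = 0) :
    ∃ F : OmegaBar k A →ₗ[k] M, ∀ a b, F (omegaMk a b) = f b a := by
  let D : Derivation k A (CoinducedModule k A M) :=
    Derivation.mk' (M := CoinducedModule k A M) f fun b b' => DFunLike.ext _ _ fun a =>
      (hmul b b' a).trans (add_comm _ _)
  let F₀ : Ω[A⁄k] →ₗ[k] M :=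
    (LinearMap.applyₗ (M := A) (M₂ := M) (1 : A)).comp
      (D.liftKaehlerDifferential.restrictScalars k : Ω[A⁄k] →ₗ[k] (A →ₗ[k] M))
  have hF₀ (a b : A) : F₀ (a • KaehlerDifferential.D k A b) = f b a := by
    change D.liftKaehlerDifferential (a • KaehlerDifferential.D k A b) 1 = _
    rw [map_smul, Derivation.liftKaehlerDifferential_comp_D, CoinducedModule.smul_apply, mul_one]
    rfl
  refine ⟨(exactForms k A).liftQ F₀ ?_, fun a b => hF₀ a b⟩
  rintro _ ⟨b, rfl⟩
  have := hF₀ 1 b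
  rw [one_smul, hone] at this
  exact this

end Omega

/-! ### The trace of a Galois extension -/

section Galois

variable (k : Type*) {R S G : Type*} [CommRing k] [CommRing R] [CommRing S] [Algebra k R]
  [Algebra k S] [Algebra R S] [IsScalarTower k R S]
  [Group G] [Fintype G] [MulSemiringAction G S] [SMulCommClass G k S]

variable (S G) in
/-- The trace `s ↦ ∑ g, g s` of a finite group acting on `S`, with values in `S`. -/
def galoisTrace : S →ₗ[k] S := ∑ g : G, (MulSemiringAction.toAlgHom k S g).toLinearMap

theorem galoisTrace_apply (s : S) : galoisTrace k S G s = ∑ g : G, g • s := by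
  simp [galoisTrace]

theorem smul_galoisTrace (g : G) (s : S) : g • galoisTrace k S G s = galoisTrace k S G s := by
  rw [galoisTrace_apply, Finset.smul_sum]
  simp_rw [← mul_smul]
  exact Fintype.sum_equiv (Equiv.mulLeft g) _ _ fun _ => rfl

theorem galoisTrace_mul {r : S} (hr : ∀ g : G, g • r = r) (s : S) :
    galoisTrace k S G (r * s) = r * galoisTrace k S G s := by
  simp only [galoisTrace_apply, smul_mul', hr, Finset.mul_sum]

theorem galoisTrace_one : galoisTrace k S G 1 = (Fintype.card G : S) := by
  simp [galoisTrace_apply]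

variable {n : ℕ} {x y : Fin n → S}

variable (G) in
/-- `x i, y i` are Galois coordinates for the action of `G` on `S`. -/
def IsGaloisCoordinates (x y : Fin n → S) : Prop :=
  ∑ i, x i * y i = 1 ∧ ∀ g : G, g ≠ 1 → ∑ i, x i * g • y i = 0

/-- Galois coordinates extract the term at the identity from a sum over the group. -/
theorem IsGaloisCoordinates.sum_smul_sum {A : Type*} [AddCommGroup A] [Module S A]
    (h : IsGaloisCoordinates G x y) (F : G → A) :
    ∑ i, x i • ∑ g : G, (g • y i) • F g = F 1 := by
  simp only [Finset.smul_sum, smul_smul]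
  rw [Finset.sum_comm]
  simp only [← Finset.sum_smul]
  rw [Finset.sum_eq_single 1 (fun g _ hg => by rw [h.2 g hg, zero_smul])
    (fun h => absurd (Finset.mem_univ _) h)]
  simp only [one_smul, h.1]

theorem IsGaloisCoordinates.sum_mul_trace (h : IsGaloisCoordinates G x y) (s : S) :
    ∑ i, x i * galoisTrace k S G (y i * s) = s := by
  simpa only [galoisTrace_apply, smul_mul', smul_eq_mul, one_smul] using
    h.sum_smul_sum fun g => g • s

theorem IsGaloisCoordinates.sum_trace_mul_trace (h : IsGaloisCoordinates G x y) (s t : S) :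
    ∑ i, galoisTrace k S G (x i * s) * galoisTrace k S G (y i * t) = galoisTrace k S G (s * t) := by
  conv_rhs => rw [← h.sum_mul_trace k t, Finset.mul_sum, map_sum]
  refine Finset.sum_congr rfl fun i _ => ?_
  rw [mul_comm, ← galoisTrace_mul k (smul_galoisTrace k · _)]
  congr 1
  ring

/-- The trace of a Galois extension `S / R`, with values in `R`. -/
theorem IsGaloisExtension.exists_trace (hGal : IsGaloisExtension R S G) :
    ∃ t : S →ₗ[k] R, ∀ s, algebraMap R S (t s) = galoisTrace k S G s := by
  have h (s : S) : ∃ r, algebraMap R S r = galoisTrace k S G s :=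
    (hGal.fixed_iff _).mp (smul_galoisTrace k · s)
  choose t ht using h
  refine ⟨⟨⟨t, fun a b => hGal.algebraMap_injective ?_⟩,
    fun c a => hGal.algebraMap_injective ?_⟩, ht⟩
  · simp only [map_add, ht]
  · change _ = IsScalarTower.toAlgHom k R S (c • t a)
    rw [map_smul, IsScalarTower.coe_toAlgHom', ht, ht, map_smul]

/-- For a Galois extension `S / R`, the map `Ω_R / dR → Ω_S / dS` is injective. Multiplication by
`a ∈ S` on the projective `R`-module `S` is given by the matrix `ρ a i j = tr (y i * a * x j)`, and
`a db ↦ ∑ i j, ρ a i j d(ρ b j i)` defines a map `Ω_S / dS → Ω_R / dR` that restricts to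
multiplication by `|G|` on `Ω_R / dR`. -/
theorem IsGaloisExtension.omegaBarMap_injective (hGal : IsGaloisExtension R S G)
    (hcard : IsUnit (Fintype.card G : k)) :
    Function.Injective (omegaBarMap (IsScalarTower.toAlgHom k R S)) := by
  obtain ⟨n, x, y, h⟩ := hGal.coordinates
  replace h : IsGaloisCoordinates G x y := h
  obtain ⟨t, ht⟩ := hGal.exists_trace k
  have htr (r : R) (s : S) : t (algebraMap R S r * s) = r * t s := by
    refine hGal.algebraMap_injective ?_
    rw [map_mul (algebraMap R S), ht, ht, galoisTrace_mul k ((hGal.fixed_iff _).mpr ⟨r, rfl⟩)]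
  let ρ (i j : Fin n) : S →ₗ[k] R := t ∘ₗ LinearMap.mulLeft k (y i * x j)
  have hρ (i j : Fin n) (a : S) : ρ i j a = t (y i * x j * a) := rfl
  have hmul (a b : S) (i j : Fin n) : ∑ l, ρ i l a * ρ l j b = ρ i j (a * b) := by
    have h1 (l) : ρ i l a * ρ l j b =
        t (y i * a * (x l * galoisTrace k S G (y l * (x j * b)))) := by
      rw [hρ, hρ, mul_comm, ← htr, ht]
      congr 1
      rw [mul_assoc (y l)]
      ring
    simp_rw [h1, ← map_sum, ← Finset.mul_sum, h.sum_mul_trace k]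
    rw [hρ]
    congr 1
    ring
  have hsmul (r : R) (i j : Fin n) : ρ i j (algebraMap R S r) = r * ρ i j 1 := by
    rw [hρ, hρ, mul_comm, htr, mul_one]
  -- The idempotent matrix `ρ 1` has trace `|G|`.
  have htrace : ∑ i, ρ i i 1 = (Fintype.card G : R) := by
    refine hGal.algebraMap_injective ?_
    simp only [hρ, ← map_sum, ht, mul_one, map_natCast, mul_comm (y _), h.1, galoisTrace_one]
  let f : S →ₗ[k] S →ₗ[k] OmegaBar k R :=
    ∑ i, ∑ j, ((omegaBilin k R).compl₁₂ (ρ i j) (ρ j i)).flip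
  have hf (b a : S) : f b a = ∑ i, ∑ j, omegaMk (ρ i j a) (ρ j i b) := by
    simp only [f, LinearMap.sum_apply]; rfl
  have hadd₁ {ι : Type} (s : Finset ι) (u : ι → R) (v : R) :
      omegaMk (k := k) (∑ i ∈ s, u i) v = ∑ i ∈ s, omegaMk (u i) v :=
    map_sum ((omegaBilin k R).flip v) u s
  have hadd₂ {ι : Type} (s : Finset ι) (u : ι → R) (v : R) :
      omegaMk (k := k) v (∑ i ∈ s, u i) = ∑ i ∈ s, omegaMk v (u i) :=
    map_sum (omegaBilin k R v) u s
  have hfmul (b b' a : S) : f (b * b') a = f b (b' * a) + f b' (b * a) := by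
    simp only [hf, ← hmul b b', hadd₂, omegaMk_leibniz, Finset.sum_add_distrib]
    rw [add_comm]
    congr 1
    · have (i j : Fin n) : omegaMk (k := k) (ρ i j (b' * a)) (ρ j i b) =
          ∑ l, omegaMk (ρ l j a * ρ i l b') (ρ j i b) := by
        rw [← hmul, hadd₁]
        simp only [mul_comm]
      simp only [this]
      exact Finset.sum_comm.trans
        ((Finset.sum_congr rfl fun j _ => Finset.sum_comm).trans Finset.sum_comm)
    · have (i j : Fin n) : omegaMk (k := k) (ρ i j (b * a)) (ρ j i b') =
          ∑ l, omegaMk (ρ i l a * ρ l j b) (ρ j i b') := by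
        rw [mul_comm b a, ← hmul, hadd₁]
      simp only [this]
      exact Finset.sum_congr rfl fun i _ => Finset.sum_comm
  have hfskew (a b : S) : f b a = - f a b := by
    simp only [hf]
    rw [Finset.sum_comm, ← Finset.sum_neg_distrib]
    refine Finset.sum_congr rfl fun i _ => ?_
    rw [← Finset.sum_neg_distrib]
    exact Finset.sum_congr rfl fun j _ => omegaMk_skew _ _
  have hf_one (a : S) : f 1 a = 0 := by
    have := hfmul 1 1 a
    rwa [one_mul, one_mul, left_eq_add] at this
  -- the map `a db ↦ ∑ i j, ρ a i j d(ρ b j i)`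
  obtain ⟨F, hF⟩ := exists_omegaBar_lift f hfmul fun b => by rw [hfskew, hf_one, neg_zero]
  have hFmap (w : OmegaBar k R) :
      F (omegaBarMap (IsScalarTower.toAlgHom k R S) w) = (Fintype.card G : k) • w := by
    induction w using omegaBar_induction with
    | add w w' h h' => rw [map_add, map_add, h, h', smul_add]
    | mk a b =>
      rw [omegaBarMap_mk, hF]
      simp only [IsScalarTower.coe_toAlgHom']
      have h1 : f 1 (algebraMap R S (a * b)) = 0 := hf_one _
      rw [hf] at h1 ⊢
      have h2 (i j : Fin n) : omegaMk (k := k) (ρ i j (algebraMap R S a))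
          (ρ j i (algebraMap R S b)) =
          omegaMk (ρ i j (algebraMap R S (a * b))) (ρ j i 1) +
            omegaMk (a * (ρ i j 1 * ρ j i 1)) b := by
        simp only [hsmul, omegaMk_leibniz]
        congr 2 <;> ring
      simp only [h2, Finset.sum_add_distrib, h1, zero_add, ← hadd₁, ← Finset.mul_sum, hmul,
        mul_one, htrace]
      rw [mul_comm, ← map_natCast (algebraMap k R), ← Algebra.smul_def]
      exact LinearMap.map_smul₂ (omegaBilin k R) _ _ _
  refine fun w w' hw => hcard.smul_left_cancel.mp ?_
  rw [← hFmap, hw, hFmap]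

end Galois

/-! ### The twisted Galois action -/

section Twist

variable {k S 𝔤 G : Type*} [Field k] [CommRing S] [Algebra k S]
  [LieRing 𝔤] [LieAlgebra k 𝔤] [Group G] [MulSemiringAction G S] [SMulCommClass G k S]

theorem galoisAct_tmul (g : G) (s : S) (x : 𝔤) :
    galoisAct k 𝔤 g (s ⊗ₜ[k] x) = (g • s) ⊗ₜ[k] x :=
  LieAlgebra.ExtendScalars.map_apply_tmul ..

theorem galoisAct_smul (g : G) (s : S) (X : S ⊗[k] 𝔤) :
    galoisAct k 𝔤 g (s • X) = (g • s) • galoisAct k 𝔤 g X := by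
  induction X with
  | zero => simp
  | add X Y hX hY => simp only [smul_add, map_add, hX, hY]
  | tmul t x => simp only [TensorProduct.smul_tmul', galoisAct_tmul, smul_eq_mul, smul_mul']

theorem galoisAct_one (X : S ⊗[k] 𝔤) : galoisAct k 𝔤 (1 : G) X = X := by
  induction X with
  | zero => simp
  | add X Y hX hY => simp only [map_add, hX, hY]
  | tmul t x => rw [galoisAct_tmul, one_smul]

theorem galoisAct_mul (g h : G) (X : S ⊗[k] 𝔤) :
    galoisAct k 𝔤 (g * h) X = galoisAct k 𝔤 g (galoisAct k 𝔤 h X) := by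
  induction X with
  | zero => simp
  | add X Y hX hY => simp only [map_add, hX, hY]
  | tmul t x => simp only [galoisAct_tmul, mul_smul]

variable (u : G → (S ⊗[k] 𝔤) ≃ₗ⁅S⁆ (S ⊗[k] 𝔤))

/-- The Galois action on `𝔤_S` twisted by `u`; its fixed points are `descended u`. -/
def twist (g : G) : S ⊗[k] 𝔤 →ₗ[k] S ⊗[k] 𝔤 :=
  ((u g).toLinearEquiv.toLinearMap.restrictScalars k) ∘ₗ (galoisAct k (S := S) 𝔤 g).toLinearMap

variable {u}

theorem twist_apply (g : G) (X : S ⊗[k] 𝔤) : twist u g X = u g (galoisAct k 𝔤 g X) := rfl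

theorem mem_descended {X : S ⊗[k] 𝔤} : X ∈ descended u ↔ ∀ g, twist u g X = X := Iff.rfl

theorem twist_smul (g : G) (s : S) (X : S ⊗[k] 𝔤) : twist u g (s • X) = (g • s) • twist u g X := by
  rw [twist_apply, galoisAct_smul, map_smul, twist_apply]

theorem smul_mem_descended {s : S} (hs : ∀ g : G, g • s = s) {X : S ⊗[k] 𝔤}
    (hX : X ∈ descended u) : s • X ∈ descended u :=
  mem_descended.mpr fun g => by rw [twist_smul, hs, mem_descended.mp hX]

theorem IsCocycle.twist_mul (hu : IsCocycle u) (g h : G) (X : S ⊗[k] 𝔤) :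
    twist u (g * h) X = twist u g (twist u h X) := by
  rw [twist_apply, hu, ← galoisAct_mul, inv_mul_cancel_left, twist_apply, twist_apply]

theorem IsCocycle.twist_one (hu : IsCocycle u) (X : S ⊗[k] 𝔤) : twist u 1 X = X := by
  have h := hu.twist_mul 1 1 X
  rw [mul_one] at h
  have h' : galoisAct k 𝔤 (1 : G) X = galoisAct k 𝔤 (1 : G) (twist u 1 X) := (u 1).injective h
  rw [galoisAct_one, galoisAct_one] at h'
  exact h'.symm

variable [Fintype G]

variable (u) in
/-- The trace of the twisted Galois action. -/
def twistedTrace : S ⊗[k] 𝔤 →ₗ[k] S ⊗[k] 𝔤 := ∑ g, twist u g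

theorem twistedTrace_apply (X : S ⊗[k] 𝔤) : twistedTrace u X = ∑ g, twist u g X := by
  simp [twistedTrace]

theorem IsCocycle.twistedTrace_mem (hu : IsCocycle u) (X : S ⊗[k] 𝔤) :
    twistedTrace u X ∈ descended u := by
  refine mem_descended.mpr fun g => ?_
  rw [twistedTrace_apply, map_sum]
  simp_rw [← hu.twist_mul]
  exact Fintype.sum_equiv (Equiv.mulLeft g) _ _ fun _ => rfl

theorem twistedTrace_smul (s : S) {X : S ⊗[k] 𝔤} (hX : X ∈ descended u) :
    twistedTrace u (s • X) = galoisTrace k S G s • X := by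
  simp only [twistedTrace_apply, galoisTrace_apply, twist_smul, Finset.sum_smul,
    mem_descended.mp hX]

theorem twistedTrace_of_mem {X : S ⊗[k] 𝔤} (hX : X ∈ descended u) :
    twistedTrace u X = (Fintype.card G : k) • X := by
  simp [twistedTrace_apply, mem_descended.mp hX, Nat.cast_smul_eq_nsmul]

variable {n : ℕ} {x y : Fin n → S}

theorem IsGaloisCoordinates.sum_smul_twistedTrace (h : IsGaloisCoordinates G x y)
    (hu : IsCocycle u) (Z : S ⊗[k] 𝔤) : ∑ i, x i • twistedTrace u (y i • Z) = Z := by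
  simpa only [twistedTrace_apply, twist_smul, hu.twist_one] using
    h.sum_smul_sum fun g => twist u g Z

/-- Galois descent: `𝔤_S` is spanned over `S` by the descended algebra. -/
theorem IsGaloisCoordinates.descended_induction (h : IsGaloisCoordinates G x y)
    (hu : IsCocycle u) {p : S ⊗[k] 𝔤 → Prop} (zero : p 0) (add : ∀ Z W, p Z → p W → p (Z + W))
    (smul : ∀ (s : S), ∀ X ∈ descended u, p (s • X)) (Z : S ⊗[k] 𝔤) : p Z := by
  rw [← h.sum_smul_twistedTrace hu Z]
  exact Finset.sum_induction _ p add zero fun i _ => smul _ _ (hu.twistedTrace_mem _)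

/-! ### Transfer of bilinear maps -/

variable {M : Type*} [AddCommGroup M] [Module k M]

variable (u) in
/-- A bilinear map `B` on `𝔤_S` is called balanced on `descended u` if scalars fixed by the Galois
group can be moved from one argument to the other. -/
def IsBalanced (B : (S ⊗[k] 𝔤) →ₗ[k] (S ⊗[k] 𝔤) →ₗ[k] M) : Prop :=
  ∀ r : S, (∀ g : G, g • r = r) → ∀ X ∈ descended u, ∀ Y ∈ descended u, B (r • X) Y = B X (r • Y)

variable (u x y) in
/-- The transfer of a bilinear map from `descended u` to `𝔤_S`: on the scalar multiples `s • X`,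
`t • Y` of elements of `descended u` it is `B (tr (s * t) • X) Y` if `B` is balanced. -/
def transfer (B : (S ⊗[k] 𝔤) →ₗ[k] (S ⊗[k] 𝔤) →ₗ[k] M) :
    (S ⊗[k] 𝔤) →ₗ[k] (S ⊗[k] 𝔤) →ₗ[k] M :=
  ∑ i, B.compl₁₂ (twistedTrace u ∘ₗ DistribSMul.toLinearMap k (S ⊗[k] 𝔤) (x i))
    (twistedTrace u ∘ₗ DistribSMul.toLinearMap k (S ⊗[k] 𝔤) (y i))

theorem transfer_apply (B : (S ⊗[k] 𝔤) →ₗ[k] (S ⊗[k] 𝔤) →ₗ[k] M) (Z W : S ⊗[k] 𝔤) :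
    transfer u x y B Z W = ∑ i, B (twistedTrace u (x i • Z)) (twistedTrace u (y i • W)) := by
  simp [transfer]

variable {B : (S ⊗[k] 𝔤) →ₗ[k] (S ⊗[k] 𝔤) →ₗ[k] M}

theorem IsBalanced.transfer_smul_smul (hB : IsBalanced u B) (h : IsGaloisCoordinates G x y)
    (s t : S) {X Y : S ⊗[k] 𝔤} (hX : X ∈ descended u) (hY : Y ∈ descended u) :
    transfer u x y B (s • X) (t • Y) = B (galoisTrace k S G (s * t) • X) Y := by
  rw [transfer_apply, ← h.sum_trace_mul_trace k, Finset.sum_smul, map_sum, LinearMap.sum_apply]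
  refine Finset.sum_congr rfl fun i _ => ?_
  rw [smul_smul, smul_smul, twistedTrace_smul _ hX, twistedTrace_smul _ hY,
    mul_comm (galoisTrace k S G (x i * s)), mul_smul]
  exact (hB _ (smul_galoisTrace k · _) _ (smul_mem_descended (smul_galoisTrace k · _) hX) _ hY).symm

theorem IsBalanced.transfer_smul (hB : IsBalanced u B) (h : IsGaloisCoordinates G x y)
    (hu : IsCocycle u) (s : S) (Z W : S ⊗[k] 𝔤) :
    transfer u x y B (s • Z) W = transfer u x y B Z (s • W) := by
  induction Z using h.descended_induction hu with
  | zero => simp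
  | add Z Z' hZ hZ' => simp only [smul_add, map_add, LinearMap.add_apply, hZ, hZ']
  | smul a X hX =>
    induction W using h.descended_induction hu with
    | zero => simp
    | add W W' hW hW' => simp only [smul_add, map_add, hW, hW']
    | smul b Y hY =>
      simp only [smul_smul, hB.transfer_smul_smul h _ _ hX hY]
      rw [show s * a * b = a * (s * b) by ring]

/-- For `c = 0` the identity expresses invariance, and for `c = 1` it is the cocycle condition. -/
theorem IsBalanced.transfer_lie (hB : IsBalanced u B) (h : IsGaloisCoordinates G x y)
    (hu : IsCocycle u) (c : k) (hc : ∀ X ∈ descended u, ∀ Y ∈ descended u, ∀ Z ∈ descended u,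
      B ⁅X, Y⁆ Z = B X ⁅Y, Z⁆ - c • B Y ⁅X, Z⁆) (X Y Z : S ⊗[k] 𝔤) :
    transfer u x y B ⁅X, Y⁆ Z =
      transfer u x y B X ⁅Y, Z⁆ - c • transfer u x y B Y ⁅X, Z⁆ := by
  induction X using h.descended_induction hu with
  | zero => simp
  | add X X' hX hX' =>
    simp only [add_lie, map_add, LinearMap.add_apply, hX, hX', smul_add]; abel
  | smul a X hX =>
    induction Y using h.descended_induction hu with
    | zero => simp
    | add Y Y' hY hY' =>
      simp only [lie_add, add_lie, map_add, LinearMap.add_apply, hY, hY', smul_add]; abel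
    | smul b Y hY =>
      induction Z using h.descended_induction hu with
      | zero => simp
      | add Z Z' hZ hZ' => simp only [lie_add, map_add, hZ, hZ', smul_add]; abel
      | smul d Z hZ =>
        have hfix := fun g : G => smul_galoisTrace k g (a * b * d)
        simp only [smul_lie, lie_smul, smul_smul]
        rw [hB.transfer_smul_smul h _ _ ((descended u).lie_mem hX hY) hZ,
          hB.transfer_smul_smul h _ _ hX ((descended u).lie_mem hY hZ),
          hB.transfer_smul_smul h _ _ hY ((descended u).lie_mem hX hZ),
          show a * (d * b) = a * b * d by ring, show b * (d * a) = a * b * d by ring,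
          mul_comm b a,
          hB _ hfix Y hY _ ((descended u).lie_mem hX hZ), ← smul_lie, ← smul_lie]
        exact hc _ (smul_mem_descended hfix hX) _ hY _ hZ

/-- A balanced bilinear map on `descended u` comes from an `Hom(S, M)`-valued bilinear map on `𝔤`
satisfying the same identity. -/
theorem IsBalanced.exists_bilinear [CharZero k] (hB : IsBalanced u B)
    (h : IsGaloisCoordinates G x y) (hu : IsCocycle u) (c : k)
    (hc : ∀ X ∈ descended u, ∀ Y ∈ descended u, ∀ Z ∈ descended u,
      B ⁅X, Y⁆ Z = B X ⁅Y, Z⁆ - c • B Y ⁅X, Z⁆) :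
    ∃ (b : 𝔤 →ₗ[k] 𝔤 →ₗ[k] (S →ₗ[k] M)) (B' : (S ⊗[k] 𝔤) →ₗ[k] (S ⊗[k] 𝔤) →ₗ[k] M),
      (∀ x y z, b ⁅x, y⁆ z = b x ⁅y, z⁆ - c • b y ⁅x, z⁆) ∧
      (∀ s t x y, B' (s ⊗ₜ x) (t ⊗ₜ y) = b x y (s * t)) ∧
      ∀ X ∈ descended u, ∀ Y ∈ descended u, B X Y = B' X Y := by
  have hcard : (Fintype.card G : k) ≠ 0 := Nat.cast_ne_zero.mpr Fintype.card_ne_zero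
  let T := (Fintype.card G : k)⁻¹ • transfer u x y B
  have hT (Z W) : T Z W = (Fintype.card G : k)⁻¹ • transfer u x y B Z W := rfl
  have hTs (s : S) (Z W : S ⊗[k] 𝔤) : T (s • Z) W = T Z (s • W) := by
    rw [hT, hT, hB.transfer_smul h hu]
  have hTl (X Y Z : S ⊗[k] 𝔤) : T ⁅X, Y⁆ Z = T X ⁅Y, Z⁆ - c • T Y ⁅X, Z⁆ := by
    rw [hT, hT, hT, hB.transfer_lie h hu c hc, smul_sub, smul_comm]
  let b : 𝔤 →ₗ[k] 𝔤 →ₗ[k] (S →ₗ[k] M) := LinearMap.mk₂ k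
    (fun x y => T.flip (1 ⊗ₜ y) ∘ₗ (TensorProduct.mk k S 𝔤).flip x)
    (fun x x' y => by ext; simp)
    (fun a x y => by ext; simp)
    (fun x y y' => by ext; simp [TensorProduct.tmul_add])
    (fun a x y => by ext; simp)
  have hb (x y s) : b x y s = T (s ⊗ₜ x) (1 ⊗ₜ y) := rfl
  refine ⟨b, T, fun x y z => LinearMap.ext fun s => ?_, fun s t x y => ?_, fun X hX Y hY => ?_⟩
  · have h1 := hTl (s ⊗ₜ x) (1 ⊗ₜ y) (1 ⊗ₜ z)
    have h2 : (s ⊗ₜ[k] ⁅x, z⁆ : S ⊗[k] 𝔤) = s • 1 ⊗ₜ ⁅x, z⁆ := by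
      rw [TensorProduct.smul_tmul', smul_eq_mul, mul_one]
    simp only [LieAlgebra.ExtendScalars.bracket_tmul, mul_one] at h1
    rw [h2, ← hTs, TensorProduct.smul_tmul', smul_eq_mul, mul_one] at h1
    simpa only [LinearMap.sub_apply, LinearMap.smul_apply, hb] using h1
  · rw [hb, mul_comm, ← smul_eq_mul, ← TensorProduct.smul_tmul', hTs, TensorProduct.smul_tmul',
      smul_eq_mul, mul_one]
  · have h1 := hB.transfer_smul_smul h 1 1 hX hY
    rw [one_smul, one_smul, mul_one, galoisTrace_one, Nat.cast_smul_eq_nsmul,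
      ← Nat.cast_smul_eq_nsmul k, map_smul, LinearMap.smul_apply] at h1
    rw [hT, h1, inv_smul_smul₀ hcard]

end Twist

/-! ### Invariant forms and cocycles on the descended algebra -/

section Descended

variable {k S 𝔤 G : Type*} [Field k] [CommRing S] [Algebra k S]
  [LieRing 𝔤] [LieAlgebra k 𝔤] [Group G] [MulSemiringAction G S] [SMulCommClass G k S]
  {u : G → (S ⊗[k] 𝔤) ≃ₗ⁅S⁆ (S ⊗[k] 𝔤)}

variable (k S 𝔤) in
/-- The `S`-valued Killing form of `𝔤_S`: `(a ⊗ x, b ⊗ y) ↦ (x | y) • (a * b)`. -/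
def currentKillingForm : (S ⊗[k] 𝔤) →ₗ[k] (S ⊗[k] 𝔤) →ₗ[k] S :=
  (TensorProduct.map₂ (LinearMap.mul k S) (killingForm k 𝔤)).compr₂
    (TensorProduct.rid k S).toLinearMap

theorem currentKillingForm_tmul (a b : S) (x y : 𝔤) :
    currentKillingForm k S 𝔤 (a ⊗ₜ x) (b ⊗ₜ y) = killingForm k 𝔤 x y • (a * b) := by
  rw [currentKillingForm, LinearMap.compr₂_apply, TensorProduct.map₂_apply_tmul]
  exact TensorProduct.rid_tmul _ _

/-- The values of the Killing form on the descended algebra are fixed by the Galois group. -/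
theorem smul_currentKillingForm {v : G → 𝔤 ≃ₗ⁅k⁆ 𝔤}
    (huv : ∀ (g : G) (s : S) (x : 𝔤), u g (s ⊗ₜ[k] x) = s ⊗ₜ[k] v g x)
    {X Y : S ⊗[k] 𝔤} (hX : X ∈ descended u) (hY : Y ∈ descended u) (g : G) :
    g • currentKillingForm k S 𝔤 X Y = currentKillingForm k S 𝔤 X Y := by
  have key (Z W : S ⊗[k] 𝔤) : currentKillingForm k S 𝔤 (twist u g Z) (twist u g W) =
      g • currentKillingForm k S 𝔤 Z W := by
    induction Z with
    | zero => simp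
    | add Z Z' h h' => simp only [map_add, LinearMap.add_apply, h, h', smul_add]
    | tmul a x =>
      induction W with
      | zero => simp
      | add W W' h h' => simp only [map_add, h, h', smul_add]
      | tmul b y =>
        simp only [twist_apply, galoisAct_tmul, huv, currentKillingForm_tmul,
          LieAlgebra.killingForm_of_equiv_apply, smul_comm g, smul_mul']
  rw [← key, mem_descended.mp hX, mem_descended.mp hY]

theorem tmul_mem_descended {v : G → 𝔤 ≃ₗ⁅k⁆ 𝔤}
    (huv : ∀ (g : G) (s : S) (x : 𝔤), u g (s ⊗ₜ[k] x) = s ⊗ₜ[k] v g x)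
    {s : S} (hs : ∀ g : G, g • s = s) {x : 𝔤} (hx : x ∈ fixedSubalgebra v) :
    s ⊗ₜ[k] x ∈ descended u :=
  mem_descended.mpr fun g => by rw [twist_apply, galoisAct_tmul, huv, hs, hx g]

variable [CharZero k] [Fintype G]

/-- The Killing form of `𝔤` does not vanish on `𝔤₀`, since averaging over `G` is self-adjoint. -/
theorem exists_killingForm_eq_one {v : G → 𝔤 ≃ₗ⁅k⁆ 𝔤} [LieAlgebra.IsKilling k 𝔤] [Nontrivial S]
    (hu : IsCocycle u)
    (huv : ∀ (g : G) (s : S) (x : 𝔤), u g (s ⊗ₜ[k] x) = s ⊗ₜ[k] v g x)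
    (h₀ : Nontrivial (fixedSubalgebra v)) :
    ∃ x ∈ fixedSubalgebra v, ∃ y ∈ fixedSubalgebra v, killingForm k 𝔤 x y = 1 := by
  have hv (g h : G) (x : 𝔤) : v (g * h) x = v g (v h x) := by
    have h1 := hu.twist_mul g h (1 ⊗ₜ x)
    simp only [twist_apply, galoisAct_tmul, huv, smul_one] at h1
    have hinj := Module.FaithfullyFlat.tensorProduct_mk_injective (A := k) (B := S) 𝔤
    exact hinj h1
  obtain ⟨⟨x, hx⟩, hx0⟩ := exists_ne (0 : fixedSubalgebra v)
  obtain ⟨y, hxy⟩ : ∃ y, killingForm k 𝔤 x y ≠ 0 := by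
    by_contra! hn
    exact hx0 (Subtype.ext
      ((LieAlgebra.IsKilling.killingForm_nondegenerate k 𝔤).1 x hn))
  let z := ∑ g, v g y
  have hz : z ∈ fixedSubalgebra v := fun g => by
    simp only [z, map_sum, ← hv]
    exact Fintype.sum_equiv (Equiv.mulLeft g) _ _ fun _ => rfl
  have hxz : killingForm k 𝔤 x z = Fintype.card G * killingForm k 𝔤 x y := by
    have (g : G) : killingForm k 𝔤 x (v g y) = killingForm k 𝔤 x y := by
      conv_lhs => rw [← hx g]
      exact LieAlgebra.killingForm_of_equiv_apply _ _ _
    simp [z, this]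
  have hxz0 : killingForm k 𝔤 x z ≠ 0 := by
    rw [hxz]
    exact mul_ne_zero (Nat.cast_ne_zero.mpr Fintype.card_ne_zero) hxy
  refine ⟨x, hx, (killingForm k 𝔤 x z)⁻¹ • z, (fixedSubalgebra v).smul_mem _ hz, ?_⟩
  rw [map_smul, smul_eq_mul, inv_mul_cancel₀ hxz0]

variable [FiniteDimensional k 𝔤] {M : Type*} [AddCommGroup M] [Module k M]
  {n : ℕ} {x y : Fin n → S}

/-- A balanced invariant bilinear map on the descended algebra factors through the Killing form. -/
theorem IsBalanced.exists_eq_killingForm {B : (S ⊗[k] 𝔤) →ₗ[k] (S ⊗[k] 𝔤) →ₗ[k] M}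
    (hB : IsBalanced u B) (h𝔤 : IsCentralSimple k 𝔤) (h : IsGaloisCoordinates G x y)
    (hu : IsCocycle u) (hc : ∀ X ∈ descended u, ∀ Y ∈ descended u, ∀ Z ∈ descended u,
      B ⁅X, Y⁆ Z = B X ⁅Y, Z⁆) :
    ∃ m : S →ₗ[k] M, ∀ X ∈ descended u, ∀ Y ∈ descended u,
      B X Y = m (currentKillingForm k S 𝔤 X Y) := by
  obtain ⟨b, B', hb, hB', hBB'⟩ := hB.exists_bilinear h hu 0 fun X hX Y hY Z hZ => by
    rw [zero_smul, sub_zero, hc X hX Y hY Z hZ]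
  obtain ⟨m, hm⟩ := h𝔤.invariant_eq b fun x y z => by rw [hb, zero_smul, sub_zero]
  refine ⟨m, fun X hX Y hY => (hBB' X hX Y hY).trans ?_⟩
  have : B' = (currentKillingForm k S 𝔤).compr₂ m := by
    ext s x t y
    simp [hB', hm, currentKillingForm_tmul]
  rw [this]
  rfl

/-- A balanced `2`-cocycle on the descended algebra is a coboundary. -/
theorem IsBalanced.exists_primitive {B : (S ⊗[k] 𝔤) →ₗ[k] (S ⊗[k] 𝔤) →ₗ[k] M}
    (hB : IsBalanced u B) [LieAlgebra.IsKilling k 𝔤] (h : IsGaloisCoordinates G x y)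
    (hu : IsCocycle u) (hc : ∀ X ∈ descended u, ∀ Y ∈ descended u, ∀ Z ∈ descended u,
      B ⁅X, Y⁆ Z = B X ⁅Y, Z⁆ - B Y ⁅X, Z⁆) :
    ∃ l : (S ⊗[k] 𝔤) →ₗ[k] M, ∀ X ∈ descended u, ∀ Y ∈ descended u, B X Y = l ⁅X, Y⁆ := by
  obtain ⟨b, B', hb, hB', hBB'⟩ := hB.exists_bilinear h hu 1 fun X hX Y hY Z hZ => by
    rw [one_smul, hc X hX Y hY Z hZ]
  obtain ⟨l, hl⟩ := exists_primitive_of_isKilling b fun x y z => by rw [hb, one_smul]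
  refine ⟨TensorProduct.lift l.flip, fun X hX Y hY => (hBB' X hX Y hY).trans ?_⟩
  have key (Z W : S ⊗[k] 𝔤) : B' Z W = TensorProduct.lift l.flip ⁅Z, W⁆ := by
    induction Z with
    | zero => simp
    | add Z Z' hZ hZ' => simp only [add_lie, map_add, LinearMap.add_apply, hZ, hZ']
    | tmul s x =>
      induction W with
      | zero => simp
      | add W W' hW hW' => simp only [lie_add, map_add, hW, hW']
      | tmul t y =>
        rw [hB', hl, LieAlgebra.ExtendScalars.bracket_tmul, TensorProduct.lift.tmul]
        rfl
  exact key X Y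

/-- The descended algebra is perfect, because `𝔤` is. -/
theorem mem_span_lie [LieAlgebra.IsKilling k 𝔤] (h : IsGaloisCoordinates G x y)
    (hu : IsCocycle u) {X : S ⊗[k] 𝔤} (hX : X ∈ descended u) :
    X ∈ Submodule.span k {Z | ∃ Y ∈ descended u, ∃ W ∈ descended u, ⁅Y, W⁆ = Z} := by
  set N := Submodule.span k {Z : S ⊗[k] 𝔤 | ∃ Y ∈ descended u, ∃ W ∈ descended u, ⁅Y, W⁆ = Z}
  have hlie (Z W : S ⊗[k] 𝔤) : twistedTrace u ⁅Z, W⁆ ∈ N := by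
    induction Z using h.descended_induction hu with
    | zero => simp
    | add Z Z' hZ hZ' => rw [add_lie, map_add]; exact add_mem hZ hZ'
    | smul a X hX =>
      induction W using h.descended_induction hu with
      | zero => simp
      | add W W' hW hW' => rw [lie_add, map_add]; exact add_mem hW hW'
      | smul b Y hY =>
        rw [smul_lie, lie_smul, smul_smul, twistedTrace_smul _ ((descended u).lie_mem hX hY),
          ← smul_lie]
        exact Submodule.subset_span
          ⟨_, smul_mem_descended (smul_galoisTrace k · _) hX, _, hY, rfl⟩
  have htrace (Z : S ⊗[k] 𝔤) : twistedTrace u Z ∈ N := by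
    induction Z with
    | zero => simp
    | add Z Z' hZ hZ' => rw [map_add]; exact add_mem hZ hZ'
    | tmul s x =>
      obtain ⟨m, e, f, -, -, hef⟩ := exists_killing_dual_bases (k := k) (𝔨 := 𝔤)
      rw [← hef x, TensorProduct.tmul_sum, map_sum]
      refine sum_mem fun i _ => ?_
      rw [← mul_one s, ← LieAlgebra.ExtendScalars.bracket_tmul]
      exact hlie _ _
  have := htrace X
  rw [twistedTrace_of_mem hX] at this
  exact (Submodule.smul_mem_iff _ (Nat.cast_ne_zero.mpr Fintype.card_ne_zero)).mp this

end Descended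

/-! ### Classification of the cocycles -/

section Cocycle

variable {k S 𝔤 G R : Type*} [Field k] [CommRing S] [Algebra k S]
  [CommRing R] [Algebra k R] [Algebra R S] [IsScalarTower k R S]
  [LieRing 𝔤] [LieAlgebra k 𝔤] [Group G] [MulSemiringAction G S] [SMulCommClass G k S]
  {u : G → (S ⊗[k] 𝔤) ≃ₗ⁅S⁆ (S ⊗[k] 𝔤)}
  {M : Type*} [AddCommGroup M] [Module k M]

/-- The failure of `h` to be balanced with respect to the scalar `r`. -/
def balanceDefect (h : (S ⊗[k] 𝔤) →ₗ[k] (S ⊗[k] 𝔤) →ₗ[k] M) (r : S) :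
    (S ⊗[k] 𝔤) →ₗ[k] (S ⊗[k] 𝔤) →ₗ[k] M :=
  h ∘ₗ DistribSMul.toLinearMap k (S ⊗[k] 𝔤) r - h.compl₂ (DistribSMul.toLinearMap k (S ⊗[k] 𝔤) r)

theorem balanceDefect_apply (h : (S ⊗[k] 𝔤) →ₗ[k] (S ⊗[k] 𝔤) →ₗ[k] M) (r : S) (X Y : S ⊗[k] 𝔤) :
    balanceDefect h r X Y = h (r • X) Y - h X (r • Y) := rfl

variable {h : (S ⊗[k] 𝔤) →ₗ[k] (S ⊗[k] 𝔤) →ₗ[k] M}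

theorem balanceDefect_lie
    (hc : ∀ X ∈ descended u, ∀ Y ∈ descended u, ∀ Z ∈ descended u,
      h ⁅X, Y⁆ Z = h X ⁅Y, Z⁆ - h Y ⁅X, Z⁆) {r : S} (hr : ∀ g : G, g • r = r)
    {X Y Z : S ⊗[k] 𝔤} (hX : X ∈ descended u) (hY : Y ∈ descended u) (hZ : Z ∈ descended u) :
    balanceDefect h r ⁅X, Y⁆ Z = balanceDefect h r X ⁅Y, Z⁆ := by
  simp only [balanceDefect_apply]
  rw [← smul_lie, hc _ (smul_mem_descended hr hX) _ hY _ hZ,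
    hc _ hX _ hY _ (smul_mem_descended hr hZ), lie_smul, lie_smul, smul_lie]
  abel

variable [CharZero k] [FiniteDimensional k 𝔤] [Fintype G]

/-- An invariant bilinear map on a perfect Lie algebra is automatically balanced. -/
theorem isBalanced_of_invariant [LieAlgebra.IsKilling k 𝔤] {n : ℕ} {x y : Fin n → S}
    (hxy : IsGaloisCoordinates G x y) (hu : IsCocycle u)
    {B : (S ⊗[k] 𝔤) →ₗ[k] (S ⊗[k] 𝔤) →ₗ[k] M}
    (hB : ∀ X ∈ descended u, ∀ Y ∈ descended u, ∀ Z ∈ descended u, B ⁅X, Y⁆ Z = B X ⁅Y, Z⁆) :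
    IsBalanced u B := by
  intro r hr X hX Y hY
  have hX' := mem_span_lie hxy hu hX
  clear hX
  induction hX' using Submodule.span_induction with
  | zero => simp
  | add X X' _ _ h h' => simp only [smul_add, map_add, LinearMap.add_apply, h, h']
  | smul c X _ h => simp only [smul_comm r c, map_smul, LinearMap.smul_apply, h]
  | mem Z hZ =>
    obtain ⟨X, hX, W, hW, rfl⟩ := hZ
    rw [← lie_smul, hB _ hX _ (smul_mem_descended hr hW) _ hY,
      hB _ hX _ hW _ (smul_mem_descended hr hY), smul_lie, lie_smul]

/-- Let `h` be a `2`-cocycle on `descended u`. Up to a linear map on `Ω_R / dR`, it is a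
coboundary. The linear map measures the failure of `h` to be balanced: that failure is an invariant
form for every `r ∈ R`, hence a function `f r` of the Killing form, and `f` is a derivation in `r`.
It vanishes on exact forms since `(x, y) ↦ h (1 ⊗ x, r ⊗ y)` is a derivation `𝔤₀ → Hom(𝔤₀, M)`,
hence inner, hence alternating. -/
theorem exists_omegaBar_of_cocycle (hGal : IsGaloisExtension R S G)
    (hu : IsCocycle u) {v : G → 𝔤 ≃ₗ⁅k⁆ 𝔤}
    (huv : ∀ (g : G) (s : S) (x : 𝔤), u g (s ⊗ₜ[k] x) = s ⊗ₜ[k] v g x)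
    (h𝔤 : IsCentralSimple k 𝔤) [LieAlgebra.IsKilling k (fixedSubalgebra v)]
    {x₀ y₀ : 𝔤} (hx₀ : x₀ ∈ fixedSubalgebra v) (hy₀ : y₀ ∈ fixedSubalgebra v)
    (hxy₀ : killingForm k 𝔤 x₀ y₀ = 1)
    (hskew : ∀ X ∈ descended u, ∀ Y ∈ descended u, h X Y = - h Y X)
    (hc : ∀ X ∈ descended u, ∀ Y ∈ descended u, ∀ Z ∈ descended u,
      h ⁅X, Y⁆ Z = h X ⁅Y, Z⁆ - h Y ⁅X, Z⁆) :
    ∃ F : OmegaBar k R →ₗ[k] M,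
      (∀ a b : R, F (omegaMk a b) = h (algebraMap R S (b * a) ⊗ₜ x₀) (1 ⊗ₜ y₀) -
        h (algebraMap R S a ⊗ₜ x₀) (algebraMap R S b ⊗ₜ y₀)) ∧
      ∃ l : (S ⊗[k] 𝔤) →ₗ[k] M ⧸ LinearMap.range F, ∀ X ∈ descended u, ∀ Y ∈ descended u,
        (LinearMap.range F).mkQ (h X Y) = l ⁅X, Y⁆ := by
  have := isKilling_of_isSimple h𝔤.1
  obtain ⟨n, x, y, hxy⟩ := hGal.coordinates
  replace hxy : IsGaloisCoordinates G x y := hxy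
  have hfix (r : R) (g : G) : g • algebraMap R S r = algebraMap R S r :=
    (hGal.fixed_iff _).mpr ⟨r, rfl⟩ g
  have hmem (r : R) {x : 𝔤} (hx : x ∈ fixedSubalgebra v) : algebraMap R S r ⊗ₜ[k] x ∈ descended u :=
    tmul_mem_descended huv (hfix r) hx
  have hmem_one {x : 𝔤} (hx : x ∈ fixedSubalgebra v) : (1 : S) ⊗ₜ[k] x ∈ descended u :=
    tmul_mem_descended huv (fun g => smul_one g) hx
  let ι : R →ₗ[k] S := (IsScalarTower.toAlgHom k R S).toLinearMap
  -- `f r s` is the defect of `h` at `r` on the pair `s ⊗ x₀, 1 ⊗ y₀`, whose Killing form is `s`.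
  let f : R →ₗ[k] R →ₗ[k] M :=
    (LinearMap.mul k R).compr₂
      ((h.flip (1 ⊗ₜ y₀)) ∘ₗ (TensorProduct.mk k S 𝔤).flip x₀ ∘ₗ ι) -
    (h.compl₁₂ ((TensorProduct.mk k S 𝔤).flip x₀ ∘ₗ ι)
      ((TensorProduct.mk k S 𝔤).flip y₀ ∘ₗ ι)).flip
  have hf (r s : R) : f r s = h (algebraMap R S (r * s) ⊗ₜ x₀) (1 ⊗ₜ y₀) -
      h (algebraMap R S s ⊗ₜ x₀) (algebraMap R S r ⊗ₜ y₀) := rfl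
  have hsmul (a b : R) (x : 𝔤) :
      algebraMap R S a • (algebraMap R S b ⊗ₜ[k] x) = algebraMap R S (a * b) ⊗ₜ x := by
    rw [TensorProduct.smul_tmul', smul_eq_mul, map_mul]
  have hsmul_one (a : R) (x : 𝔤) :
      algebraMap R S a • ((1 : S) ⊗ₜ[k] x) = algebraMap R S a ⊗ₜ x := by
    rw [TensorProduct.smul_tmul', smul_eq_mul, mul_one]
  have key (r q : R) {X Y : S ⊗[k] 𝔤} (hX : X ∈ descended u) (hY : Y ∈ descended u)
      (hq : currentKillingForm k S 𝔤 X Y = algebraMap R S q) :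
      h (algebraMap R S r • X) Y - h X (algebraMap R S r • Y) = f r q := by
    have hinv := fun X hX Y hY Z hZ =>
      balanceDefect_lie hc (hfix r) (X := X) (Y := Y) (Z := Z) hX hY hZ
    obtain ⟨m, hm⟩ := (isBalanced_of_invariant hxy hu hinv).exists_eq_killingForm h𝔤 hxy hu hinv
    have h1 := hm X hX Y hY
    rw [hq] at h1
    have h2 := hm _ (hmem q hx₀) _ (hmem_one hy₀)
    rw [currentKillingForm_tmul, hxy₀, one_smul, mul_one, ← h1, balanceDefect_apply,
      balanceDefect_apply, hsmul, hsmul_one] at h2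
    rw [← h2, hf]
  have hfmul (r r' s : R) : f (r * r') s = f r (r' * s) + f r' (r * s) := by
    have h1 := key r' (r * s) (hmem s hx₀) (hmem r hy₀) (by
      rw [currentKillingForm_tmul, hxy₀, one_smul, ← map_mul, mul_comm])
    rw [hsmul, hsmul] at h1
    rw [← h1, hf, hf, mul_comm r' r, mul_assoc]
    abel
  have hf_one (r : R) : f r 1 = 0 := by
    let incl (s : S) : fixedSubalgebra v →ₗ[k] S ⊗[k] 𝔤 :=
      TensorProduct.mk k S 𝔤 s ∘ₗ (fixedSubalgebra v).toSubmodule.subtype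
    have hincl (s : S) (x : fixedSubalgebra v) : incl s x = s ⊗ₜ (x : 𝔤) := rfl
    obtain ⟨l, hl⟩ := exists_primitive_of_isKilling
      (h.compl₁₂ (incl 1) (incl (algebraMap R S r))) fun x y z => by
        have := hc _ (hmem_one x.2) _ (hmem_one y.2) _ (hmem r z.2)
        simp only [LieAlgebra.ExtendScalars.bracket_tmul, one_mul] at this
        exact this
    have h1 := hl ⟨x₀, hx₀⟩ ⟨y₀, hy₀⟩
    have h2 := hl ⟨y₀, hy₀⟩ ⟨x₀, hx₀⟩
    simp only [LinearMap.compl₁₂_apply, hincl] at h1 h2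
    rw [hf, mul_one, map_one, hskew _ (hmem r hx₀) _ (hmem_one hy₀), h1, h2,
      ← lie_skew (⟨x₀, hx₀⟩ : fixedSubalgebra v), map_neg, sub_neg_eq_add, neg_add_cancel]
  obtain ⟨F, hF⟩ := exists_omegaBar_lift f hfmul hf_one
  refine ⟨F, fun a b => by rw [hF, hf], ?_⟩
  have hbal : IsBalanced u (h.compr₂ (LinearMap.range F).mkQ) := by
    intro s hs X hX Y hY
    obtain ⟨r, rfl⟩ := (hGal.fixed_iff s).mp hs
    obtain ⟨q, hq⟩ := (hGal.fixed_iff _).mp (smul_currentKillingForm huv hX hY)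
    rw [LinearMap.compr₂_apply, LinearMap.compr₂_apply, ← sub_eq_zero, ← map_sub,
      key r q hX hY hq.symm, ← hF]
    simp
  exact hbal.exists_primitive hxy hu fun X hX Y hY Z hZ => by
    simp only [LinearMap.compr₂_apply, hc X hX Y hY Z hZ, map_sub]

end Cocycle

/-! ### The universal property -/

section Central

variable (k : Type*) {E L : Type*} [CommRing k] [LieRing E] [LieAlgebra k E] [LieRing L]
  [LieAlgebra k L]

variable (E) in
/-- The bracket of a Lie algebra as a bilinear map. -/
def lieBilin : E →ₗ[k] E →ₗ[k] E :=
  LinearMap.mk₂ k (fun a b => ⁅a, b⁆) add_lie smul_lie lie_add lie_smul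

variable {k} {p : E →ₗ⁅k⁆ L}

theorem IsCentralExtension.lie_congr (hp : IsCentralExtension p) {a a' b b' : E}
    (ha : p a = p a') (hb : p b = p b') : ⁅a, b⁆ = ⁅a', b'⁆ := by
  have h1 := hp.central (a - a') (by rw [map_sub, ha, sub_self]) b
  have h2 := hp.central (b - b') (by rw [map_sub, hb, sub_self]) a'
  rw [sub_lie, sub_eq_zero] at h1
  rw [← lie_skew, neg_eq_zero, lie_sub, sub_eq_zero] at h2
  rw [h1, h2]

/-- A criterion for a central extension `p : E → L` with a linear section `c` to be universal: `E`
is spanned by the brackets `[c X, c Y]`, and all linear relations between these brackets are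
satisfied by every `2`-cocycle of `L` with trivial coefficients. -/
theorem IsCentralExtension.isUniversal {k : Type*} [Field k] [LieAlgebra k E] [LieAlgebra k L]
    {p : E →ₗ⁅k⁆ L} (hp : IsCentralExtension p) (c : L →ₗ[k] E) (hc : ∀ X, p (c X) = X)
    (T : (L ⊗[k] L) →ₗ[k] E) (hT : ∀ X Y, T (X ⊗ₜ Y) = ⁅c X, c Y⁆) (hsurj : Function.Surjective T)
    (hker : ∀ (M : Type w) [AddCommGroup M] [Module k M] (h : L →ₗ[k] L →ₗ[k] M),
      (∀ X Y, h X Y = - h Y X) → (∀ X Y Z, h ⁅X, Y⁆ Z = h X ⁅Y, Z⁆ - h Y ⁅X, Z⁆) →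
      LinearMap.ker T ≤ LinearMap.ker (TensorProduct.lift h)) :
    IsUniversalCentralExtension.{w} p := by
  refine { hp with existsUnique := fun N _ _ q hq => ?_ }
  obtain ⟨σ, hσ⟩ := (q : N →ₗ[k] L).exists_rightInverse_of_surjective
    (LinearMap.range_eq_top.mpr hq.surjective)
  replace hσ (X : L) : q (σ X) = X := LinearMap.congr_fun hσ X
  -- differs from the usual `ker q`-valued cocycle of the section `σ` by `σ [X, Y]`, a coboundary
  let h : L →ₗ[k] L →ₗ[k] N := (lieBilin k N).compl₁₂ σ σ
  have hh (X Y) : h X Y = ⁅σ X, σ Y⁆ := rfl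
  have hle := hker N h (fun X Y => (lie_skew _ _).symm) fun X Y Z => by
    rw [hh, hh, hh,
      hq.lie_congr (a := σ ⁅X, Y⁆) (a' := ⁅σ X, σ Y⁆) (by simp only [LieHom.map_lie, hσ]) rfl,
      hq.lie_congr (b := σ ⁅Y, Z⁆) (b' := ⁅σ Y, σ Z⁆) rfl (by simp only [LieHom.map_lie, hσ]),
      hq.lie_congr (b := σ ⁅X, Z⁆) (b' := ⁅σ X, σ Z⁆) rfl (by simp only [LieHom.map_lie, hσ])]
    exact lie_lie _ _ _
  obtain ⟨τ, hτ⟩ := T.exists_rightInverse_of_surjective (LinearMap.range_eq_top.mpr hsurj)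
  let ψ : E →ₗ[k] N := TensorProduct.lift h ∘ₗ τ
  have hψ (t) : ψ (T t) = TensorProduct.lift h t := by
    refine sub_eq_zero.mp ((map_sub _ _ _).symm.trans (hle ?_))
    rw [LinearMap.mem_ker, map_sub, sub_eq_zero]
    exact LinearMap.congr_fun hτ _
  have hqψ (a) : q (ψ a) = p a := by
    obtain ⟨t, rfl⟩ := hsurj a
    rw [hψ]
    induction t with
    | zero => simp
    | add t t' ht ht' => simp only [map_add, ht, ht']
    | tmul X Y =>
      rw [TensorProduct.lift.tmul, hh, LieHom.map_lie, hσ, hσ, hT, LieHom.map_lie, hc, hc]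
  have hψ_lie (a b) : ψ ⁅a, b⁆ = ⁅ψ a, ψ b⁆ := by
    rw [hp.lie_congr (hc (p a)).symm (hc (p b)).symm, ← hT, hψ, TensorProduct.lift.tmul, hh]
    exact hq.lie_congr ((hσ _).trans (hqψ a).symm) ((hσ _).trans (hqψ b).symm)
  let ψL : E →ₗ⁅k⁆ N := { ψ with map_lie' := hψ_lie _ _ }
  refine ⟨ψL, LieHom.ext hqψ, fun ψ' hψ' => LieHom.ext fun a => ?_⟩
  change ψ' a = ψ a
  obtain ⟨t, rfl⟩ := hsurj a
  rw [hψ]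
  induction t with
  | zero => simp
  | add t t' ht ht' => simp only [map_add, ht, ht']
  | tmul X Y =>
    have hproj (X) : q (ψ' (c X)) = q (σ X) :=
      (LieHom.congr_fun hψ' _).trans ((hc X).trans (hσ X).symm)
    rw [TensorProduct.lift.tmul, hh, hT, LieHom.map_lie]
    exact hq.lie_congr (hproj X) (hproj Y)

end Central

section Kassel

variable {k S 𝔤 G : Type*} [Field k] [CharZero k] [CommRing S] [Algebra k S]
  [LieRing 𝔤] [LieAlgebra k 𝔤]

theorem KasselAlgebra.ext {a b : KasselAlgebra k S 𝔤} (h₁ : a.fst = b.fst) (h₂ : a.snd = b.snd) :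
    a = b :=
  congrArg (fun p : (S ⊗[k] 𝔤) × OmegaBar k S => KasselAlgebra.mk p.1 p.2)
    (Prod.ext h₁ h₂ : (a.fst, a.snd) = (b.fst, b.snd))

theorem KasselAlgebra.lie_eq (a b : KasselAlgebra k S 𝔤) :
    ⁅a, b⁆ = KasselAlgebra.mk ⁅a.fst, b.fst⁆ (kasselForm k S 𝔤 a.fst b.fst) :=
  KasselAlgebra.bracket_mk a.fst b.fst a.snd b.snd

variable (k S 𝔤) in
/-- The projection `𝔤_S ⊕ Ω_S / dS → Ω_S / dS`, which is only linear. -/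
def kasselSnd : KasselAlgebra k S 𝔤 →ₗ[k] OmegaBar k S where
  toFun x := x.snd
  map_add' _ _ := rfl
  map_smul' _ _ := rfl

variable {R : Type*} [CommRing R] [Algebra k R] [Algebra R S] [IsScalarTower k R S]
  [Group G] [MulSemiringAction G S] [SMulCommClass G k S]
  {u : G → (S ⊗[k] 𝔤) ≃ₗ⁅S⁆ (S ⊗[k] 𝔤)} {uh : G → KasselAlgebra k S 𝔤 ≃ₗ⁅k⁆ KasselAlgebra k S 𝔤}

/-- The inclusion of `descended u` into `descendedHat uh`, which is only linear. -/
def descendedIncl (hsplit : ∀ x : KasselAlgebra k S 𝔤, x ∈ descendedHat uh ↔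
      x.fst ∈ descended u ∧
        x.snd ∈ LinearMap.range (omegaBarMap (IsScalarTower.toAlgHom k R S))) :
    descended u →ₗ[k] descendedHat uh where
  toFun X := ⟨.mk X 0, (hsplit _).mpr ⟨X.2, zero_mem _⟩⟩
  map_add' _ _ := Subtype.ext (KasselAlgebra.ext rfl (add_zero _).symm)
  map_smul' c _ := Subtype.ext (KasselAlgebra.ext rfl (smul_zero c).symm)

/-- The linear map `X ⊗ Y ↦ [X ⊕ 0, Y ⊕ 0]` to `descendedHat uh`. -/
def descendedBracket (hsplit : ∀ x : KasselAlgebra k S 𝔤, x ∈ descendedHat uh ↔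
      x.fst ∈ descended u ∧
        x.snd ∈ LinearMap.range (omegaBarMap (IsScalarTower.toAlgHom k R S))) :
    (descended u ⊗[k] descended u) →ₗ[k] descendedHat uh :=
  TensorProduct.lift ((lieBilin k (descendedHat uh)).compl₁₂
    (descendedIncl hsplit) (descendedIncl hsplit))

variable (hsplit : ∀ x : KasselAlgebra k S 𝔤, x ∈ descendedHat uh ↔
      x.fst ∈ descended u ∧
        x.snd ∈ LinearMap.range (omegaBarMap (IsScalarTower.toAlgHom k R S)))

theorem descendedBracket_tmul (X Y : descended u) :
    descendedBracket hsplit (X ⊗ₜ Y) = ⁅descendedIncl hsplit X, descendedIncl hsplit Y⁆ := rfl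

theorem descendedBracket_tmul_coe (X Y : descended u) :
    (descendedBracket hsplit (X ⊗ₜ Y) : KasselAlgebra k S 𝔤) =
      .mk ⁅(X : S ⊗[k] 𝔤), (Y : S ⊗[k] 𝔤)⁆ (kasselForm k S 𝔤 X Y) :=
  KasselAlgebra.bracket_mk (X : S ⊗[k] 𝔤) (Y : S ⊗[k] 𝔤) 0 0

variable [Fintype G] [FiniteDimensional k 𝔤]

/-- The algebra `descendedHat uh` is spanned by brackets of elements of `descended u`. -/
theorem descendedBracket_surjective (hGal : IsGaloisExtension R S G)
    (hu : IsCocycle u) {v : G → 𝔤 ≃ₗ⁅k⁆ 𝔤}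
    (huv : ∀ (g : G) (s : S) (x : 𝔤), u g (s ⊗ₜ[k] x) = s ⊗ₜ[k] v g x)
    [LieAlgebra.IsKilling k 𝔤]
    {x₀ y₀ : 𝔤} (hx₀ : x₀ ∈ fixedSubalgebra v) (hy₀ : y₀ ∈ fixedSubalgebra v)
    (hxy₀ : killingForm k 𝔤 x₀ y₀ = 1) :
    Function.Surjective (descendedBracket hsplit) := by
  obtain ⟨n, x, y, hxy⟩ := hGal.coordinates
  replace hxy : IsGaloisCoordinates G x y := hxy
  let N := LinearMap.range (descendedBracket hsplit)
  have hfix (r : R) (g : G) : g • algebraMap R S r = algebraMap R S r :=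
    (hGal.fixed_iff _).mpr ⟨r, rfl⟩ g
  have hmem (r : R) {x : 𝔤} (hx : x ∈ fixedSubalgebra v) : algebraMap R S r ⊗ₜ[k] x ∈ descended u :=
    tmul_mem_descended huv (hfix r) hx
  -- `a db` arises from the difference of the brackets of `a ⊗ x₀, b ⊗ y₀` and `a b ⊗ x₀, 1 ⊗ y₀`.
  have homega (w : OmegaBar k R) : ∃ e ∈ N,
      (e : KasselAlgebra k S 𝔤) = .mk 0 (omegaBarMap (IsScalarTower.toAlgHom k R S) w) := by
    induction w using omegaBar_induction with
    | add w w' h h' =>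
      obtain ⟨e, he, h⟩ := h
      obtain ⟨e', he', h'⟩ := h'
      refine ⟨e + e', add_mem he he', ?_⟩
      rw [AddMemClass.coe_add, h, h', map_add]
      exact KasselAlgebra.ext (add_zero _) rfl
    | mk a b =>
      refine ⟨_, sub_mem
        ⟨(⟨_, hmem a hx₀⟩ : descended u) ⊗ₜ (⟨_, hmem b hy₀⟩ : descended u), rfl⟩
        ⟨(⟨_, hmem (a * b) hx₀⟩ : descended u) ⊗ₜ (⟨_, hmem 1 hy₀⟩ : descended u), rfl⟩, ?_⟩
      rw [AddSubgroupClass.coe_sub, descendedBracket_tmul_coe, descendedBracket_tmul_coe]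
      refine KasselAlgebra.ext ?_ ?_
      · refine (congrArg₂ (· - ·) (LieAlgebra.ExtendScalars.bracket_tmul ..)
          (LieAlgebra.ExtendScalars.bracket_tmul ..)).trans ?_
        rw [map_mul, map_one, mul_one, sub_self]
        rfl
      · refine (congrArg₂ (· - ·) (kasselForm_tmul ..) (kasselForm_tmul ..)).trans ?_
        rw [hxy₀, one_smul, one_smul, map_one, omegaMk_skew _ 1, omegaMk_one, neg_zero, sub_zero,
          omegaBarMap_mk]
        rfl
  have hfst {X : S ⊗[k] 𝔤} (hX : X ∈ descended u) : ∃ e ∈ N, kasselProj k S 𝔤 e = X := by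
    have hX' := mem_span_lie hxy hu hX
    clear hX
    induction hX' using Submodule.span_induction with
    | zero => exact ⟨0, zero_mem _, rfl⟩
    | add X X' _ _ h h' =>
      obtain ⟨e, he, rfl⟩ := h
      obtain ⟨e', he', rfl⟩ := h'
      exact ⟨e + e', add_mem he he', rfl⟩
    | smul c X _ h =>
      obtain ⟨e, he, rfl⟩ := h
      exact ⟨c • e, N.smul_mem c he, rfl⟩
    | mem Z hZ =>
      obtain ⟨X, hX, Y, hY, rfl⟩ := hZ
      exact ⟨_, ⟨(⟨X, hX⟩ : descended u) ⊗ₜ (⟨Y, hY⟩ : descended u), rfl⟩,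
        congrArg (kasselProj k S 𝔤) (descendedBracket_tmul_coe hsplit ⟨X, hX⟩ ⟨Y, hY⟩)⟩
  intro e
  obtain ⟨e₁, he₁, h₁⟩ := hfst ((hsplit e).mp e.2).1
  obtain ⟨w, hw⟩ := ((hsplit _).mp (e - e₁).2).2
  obtain ⟨e₂, he₂, h₂⟩ := homega w
  have : e = e₁ + e₂ := by
    rw [← sub_eq_iff_eq_add']
    refine Subtype.ext (KasselAlgebra.ext ?_ ?_)
    · rw [h₂]
      exact sub_eq_zero.mpr h₁.symm
    · rw [h₂, hw]
      rfl
  rw [this]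
  exact add_mem he₁ he₂

end Kassel

section Kernel

variable {k S 𝔤 G : Type*} [Field k] [CharZero k] [CommRing S] [Algebra k S]
  [LieRing 𝔤] [LieAlgebra k 𝔤] [Group G] [Fintype G] [MulSemiringAction G S] [SMulCommClass G k S]
  {u : G → (S ⊗[k] 𝔤) ≃ₗ⁅S⁆ (S ⊗[k] 𝔤)}

/-- The averaging projection of `𝔤_S` onto `descended u`. -/
theorem IsCocycle.exists_projection (hu : IsCocycle u) :
    ∃ π : (S ⊗[k] 𝔤) →ₗ[k] descended u, ∀ X : descended u, π X = X := by
  refine ⟨(Fintype.card G : k)⁻¹ • (twistedTrace u).codRestrict (descended u).toSubmodule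
    hu.twistedTrace_mem, fun X => Subtype.ext ?_⟩
  change (Fintype.card G : k)⁻¹ • twistedTrace u (X : S ⊗[k] 𝔤) = X
  rw [twistedTrace_of_mem X.2, inv_smul_smul₀ (Nat.cast_ne_zero.mpr Fintype.card_ne_zero)]


variable {R : Type*} [CommRing R] [Algebra k R] [Algebra R S] [IsScalarTower k R S]
  [FiniteDimensional k 𝔤] {uh : G → KasselAlgebra k S 𝔤 ≃ₗ⁅k⁆ KasselAlgebra k S 𝔤}
  (hsplit : ∀ x : KasselAlgebra k S 𝔤, x ∈ descendedHat uh ↔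
      x.fst ∈ descended u ∧
        x.snd ∈ LinearMap.range (omegaBarMap (IsScalarTower.toAlgHom k R S)))

/-- Every `2`-cocycle on `descended u` vanishes on the relations between the brackets in
`descendedHat uh`. This applies `exists_omegaBar_of_cocycle` to the given cocycle together with the
Kassel cocycle, for which the linear map on `Ω_R / dR` is the negative of the injective map
`Ω_R / dR → Ω_S / dS`. -/
theorem ker_descendedBracket_le (hGal : IsGaloisExtension R S G)
    (hu : IsCocycle u) {v : G → 𝔤 ≃ₗ⁅k⁆ 𝔤}
    (huv : ∀ (g : G) (s : S) (x : 𝔤), u g (s ⊗ₜ[k] x) = s ⊗ₜ[k] v g x)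
    (h𝔤 : IsCentralSimple k 𝔤) [LieAlgebra.IsKilling k (fixedSubalgebra v)]
    {x₀ y₀ : 𝔤} (hx₀ : x₀ ∈ fixedSubalgebra v) (hy₀ : y₀ ∈ fixedSubalgebra v)
    (hxy₀ : killingForm k 𝔤 x₀ y₀ = 1)
    {M : Type*} [AddCommGroup M] [Module k M] (h : descended u →ₗ[k] descended u →ₗ[k] M)
    (hskew : ∀ X Y, h X Y = - h Y X) (hc : ∀ X Y Z, h ⁅X, Y⁆ Z = h X ⁅Y, Z⁆ - h Y ⁅X, Z⁆) :
    LinearMap.ker (descendedBracket hsplit) ≤ LinearMap.ker (TensorProduct.lift h) := by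
  obtain ⟨π, hπ⟩ := hu.exists_projection
  let h' : (S ⊗[k] 𝔤) →ₗ[k] (S ⊗[k] 𝔤) →ₗ[k] M × OmegaBar k S :=
    (h.compl₁₂ π π).compr₂ (LinearMap.inl k M (OmegaBar k S)) +
      (kasselForm k S 𝔤).compr₂ (LinearMap.inr k M (OmegaBar k S))
  have hh' (X Y : descended u) : h' X Y = (h X Y, kasselForm k S 𝔤 X Y) := by
    simp [h', hπ]
  have hh'_snd (X Y : S ⊗[k] 𝔤) : (h' X Y).2 = kasselForm k S 𝔤 X Y := by
    simp [h']
  obtain ⟨F, hF, l, hl⟩ := exists_omegaBar_of_cocycle (h := h') hGal hu huv h𝔤 hx₀ hy₀ hxy₀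
    (fun X hX Y hY => by
      rw [hh' ⟨X, hX⟩ ⟨Y, hY⟩, hh' ⟨Y, hY⟩ ⟨X, hX⟩, hskew, kasselForm_skew]; rfl)
    (fun X hX Y hY Z hZ => by
      let X' : descended u := ⟨X, hX⟩
      let Y' : descended u := ⟨Y, hY⟩
      let Z' : descended u := ⟨Z, hZ⟩
      refine (hh' ⁅X', Y'⁆ Z').trans (Eq.trans ?_
        (congrArg₂ (· - ·) (hh' X' ⁅Y', Z'⁆) (hh' Y' ⁅X', Z'⁆)).symm)
      refine Prod.ext (hc X' Y' Z') ?_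
      exact eq_sub_of_add_eq (kasselForm_cocycle k S 𝔤 X Y Z).symm)
  have hF_snd (w : OmegaBar k R) : (F w).2 = - omegaBarMap (IsScalarTower.toAlgHom k R S) w := by
    induction w using omegaBar_induction with
    | add w w' h h' => rw [map_add, Prod.snd_add, h, h', map_add, neg_add]
    | mk a b =>
      rw [hF, Prod.snd_sub, hh'_snd, hh'_snd, kasselForm_tmul, kasselForm_tmul, hxy₀, one_smul,
        one_smul, omegaMk_skew _ 1, omegaMk_one, neg_zero, zero_sub, omegaBarMap_mk]
      rfl
  let H : (descended u ⊗[k] descended u) →ₗ[k] M × OmegaBar k S :=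
    (TensorProduct.lift h).prod (kasselSnd k S 𝔤 ∘ₗ (descendedHat uh).toSubmodule.subtype ∘ₗ
      descendedBracket hsplit)
  have hH : (LinearMap.range F).mkQ ∘ₗ H = l ∘ₗ (kasselProj k S 𝔤).toLinearMap ∘ₗ
      (descendedHat uh).toSubmodule.subtype ∘ₗ descendedBracket hsplit := by
    refine TensorProduct.ext' fun X Y => ?_
    refine Eq.trans ?_ (hl X X.2 Y Y.2)
    rw [hh']
    exact congrArg (LinearMap.range F).mkQ
      (Prod.ext rfl (congrArg (kasselSnd k S 𝔤) (descendedBracket_tmul_coe hsplit X Y)))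
  intro t ht
  rw [LinearMap.mem_ker] at ht ⊢
  have h1 : (LinearMap.range F).mkQ (H t) = 0 := by
    refine (LinearMap.congr_fun hH t).trans ?_
    simp only [LinearMap.comp_apply, ht, map_zero]
  obtain ⟨w, hw⟩ := (Submodule.Quotient.mk_eq_zero _).mp h1
  have h2 : (H t).2 = 0 := by
    change kasselSnd k S 𝔤 (descendedBracket hsplit t : KasselAlgebra k S 𝔤) = 0
    rw [ht]
    rfl
  rw [← hw, hF_snd, neg_eq_zero] at h2
  have h3 : w = 0 := by
    refine hGal.omegaBarMap_injective (k := k)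
      (Nat.cast_ne_zero.mpr Fintype.card_ne_zero).isUnit (h2.trans (map_zero _).symm)
  rw [h3, map_zero] at hw
  exact congrArg Prod.fst hw.symm

end Kernel

end TwistedUCE

end

open TwistedUCE in
theorem proposition3p7
    -- the base field, the split simple Lie algebra, and the Galois extension
    {k : Type*} [Field k] [CharZero k]
    {𝔤 : Type*} [LieRing 𝔤] [LieAlgebra k 𝔤] [FiniteDimensional k 𝔤]
    (h𝔤 : IsSplitSimple k 𝔤)
    {R : Type*} {S : Type*} [CommRing R] [CommRing S] [Algebra k R] [Algebra k S]
    [Algebra R S] [IsScalarTower k R S]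
    {G : Type*} [Group G] [MulSemiringAction G S] [SMulCommClass G k S]
    (hGal : IsGaloisExtension R S G)
    -- the constant cocycle `u g = v g ⊗ id`
    (u : G → (S ⊗[k] 𝔤) ≃ₗ⁅S⁆ (S ⊗[k] 𝔤)) (hu : IsCocycle u)
    (v : G → 𝔤 ≃ₗ⁅k⁆ 𝔤)
    (huv : ∀ (g : G) (s : S) (x : 𝔤), u g (s ⊗ₜ[k] x) = s ⊗ₜ[k] v g x)
    -- the lift of `u` to `𝔤_S ⊕ Ω_S / dS`
    (uh : G → KasselAlgebra k S 𝔤 ≃ₗ⁅k⁆ KasselAlgebra k S 𝔤) (huh : IsLift u uh)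
    -- `𝔤₀` is central simple
    (h₀ : IsCentralSimple k (fixedSubalgebra v))
    -- `𝔤` has a basis of simultaneous eigenvectors of the `v g`
    (hbasis : ∃ b : Module.Basis (Fin (Module.finrank k 𝔤)) k 𝔤,
      ∀ (g : G) (i : Fin (Module.finrank k 𝔤)), ∃ c : k, v g (b i) = c • b i)
    -- `L_û = L_u ⊕ Ω_R / dR` inside `𝔤_S ⊕ Ω_S / dS`
    (hsplit : ∀ x : KasselAlgebra k S 𝔤, x ∈ descendedHat uh ↔
      x.fst ∈ descended u ∧
        x.snd ∈ LinearMap.range (omegaBarMap (IsScalarTower.toAlgHom k R S))) :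
    IsUniversalCentralExtension.{w} (descendedProj huh) := by
  have := hGal.finite
  have := Fintype.ofFinite G
  have := isKilling_of_isSimple h𝔤.1
  have := isKilling_of_isSimple h₀.1
  have hcentral : IsCentralExtension (descendedProj huh) := by
    refine { surjective := fun X => ⟨descendedIncl hsplit X, rfl⟩, central := fun a ha b => ?_ }
    have hfst : (a : KasselAlgebra k S 𝔤).fst = 0 := congrArg Subtype.val ha
    refine Subtype.ext ((KasselAlgebra.lie_eq _ _).trans ?_)
    rw [hfst, zero_lie, map_zero]
    rfl
  -- For `S = 0` there is nothing to show, but `v` need not be multiplicative.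
  rcases subsingleton_or_nontrivial S with hS | hS
  · have : Subsingleton (S ⊗[k] 𝔤) := Module.subsingleton S (S ⊗[k] 𝔤)
    have : Subsingleton (Ω[S⁄k]) := Module.subsingleton S _
    have : Subsingleton (descendedHat uh) := ⟨fun a b =>
      Subtype.ext (KasselAlgebra.ext (Subsingleton.elim _ _) (Subsingleton.elim _ _))⟩
    refine { hcentral with existsUnique := fun N _ _ q _ =>
      ⟨0, LieHom.ext fun a => Subsingleton.elim _ _, fun ψ _ => LieHom.ext fun a => ?_⟩ }
    rw [Subsingleton.elim a 0, map_zero, map_zero]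
  have h₀' : Nontrivial (fixedSubalgebra v) := by
    by_contra hn
    rw [not_nontrivial_iff_subsingleton] at hn
    exact h₀.1.non_abelian ⟨fun _ _ => Subsingleton.elim _ _⟩
  obtain ⟨x₀, hx₀, y₀, hy₀, hxy₀⟩ := exists_killingForm_eq_one hu huv h₀'
  exact hcentral.isUniversal (descendedIncl hsplit) (fun _ => rfl) (descendedBracket hsplit)
    (descendedBracket_tmul hsplit) (descendedBracket_surjective hsplit hGal hu huv hx₀ hy₀ hxy₀)
    fun _ _ _ => ker_descendedBracket_le hsplit hGal hu huv h𝔤.isCentralSimple hx₀ hy₀ hxy₀
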